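/- Fix integers $t\ge 0$, $k=2t+1$ and $w\ge k+1$, and put $H(t)=H_{k+1}-H_{t+1}$, where $H_n$ denotes the $n$-th harmonic number. A jumplist on $n$ keys $x_1<\dots<x_n$ has $m=n+1$ nodes: a dummy header $v_0$ (with key $-\infty$) and nodes $v_1,\dots,v_n$ storing the keys, linked in this order. If $m\le w$, all nodes are plain. If $m>w$, then $v_0$ is a jump node with a jump pointer to some $v_j$, $2\le j\le n$; the next-sublist $v_1,\dots,v_{j-1}$ and the jump-sublist $v_j,\dots,v_n$ (whose first nodes serve as headers) are recursively jumplists on $J_1=j-1$ and $J_2=m-j$ nodes. In the random median-of-$k$ jumplist with leaf size $w$, a configuration $\mathcal J$ with sublists $\mathcal J_1,\mathcal J_2$ has probability $p(\mathcal J)=1$ if $m\le w$, and $p(\mathcal J)=\binom{J_1-1}{t}\binom{J_2-1}{t}\binom{m-2}{k}^{-1}p(\mathcal J_1)p(\mathcal J_2)$ if $m>w$. Spine search for $x$ starts at $v_0$; as long as the current node is a jump node, it compares the key of the jump target with $x$, moves to the target if that key is $<x$, and to the next node otherwise. When a plain node is reached, it returns to the last node that was entered through a jump pointer (or to $v_0$),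 and from there compares successive keys with $x$ until the first key $\ge x$ (or the sentinel $+\infty$ at the end of the list) is met. Cleanup after insertion: let $m$ be the size of the current sublist including the new node, and $r$ the number of its nodes that precede the new node. If $m\le w$, nothing happens; if $m=w+1$, the $m$ elements are rebalanced. If $m>w+1$, then with probability $k/(m-2)$ all $m$ elements are rebalanced and the cleanup ends; otherwise the topmost jump pointer is kept (if $r=0$, the new node takes it over from the old header) and the cleanup continues in the next-sublist with rank $\max\{0,r-1\}$ if $r\le J_1+1$, and in the jump-sublist with rank $r-1-J_1$ otherwise ($J_1$ being the old size of the next-sublist). Cleanup after deletion: let $m$ be the size of the current sublist after the deletion, $r$ the rank of the deleted node ($r=0$ for the header), and $J_1,J_2$ the sizes of the next- and jump-sublist before the deletion. If $m<w$, nothing happens; if $m=w$, the header is turned into a plain node, which counts as one rebalanced element. If $m>w$, then all $m$ elements are rebalanced, and the cleanup ends, with probability $1$ if $r=J_1+1$, with probability $t/(J_1-1)$ (where $0/0:=1$) if $r<J_1+1$, and with probability $t/(J_2-1)$ if $r>J_1+1$; otherwise the topmost jump pointer is kept and the cleanup continues in the next-sublist with rank $\max\{0,r-1\}$ if $r<J_1+1$,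 and in the jump-sublist with rank $r-1-J_1$ if $r>J_1+1$. Consider a random median-of-$k$ jumplist with leaf size $w$ on $n$ keys, where $k$ and $w$ are fixed and $n\to\infty$. Then: 1. The expected number of key comparisons of a spine search, for an $x$ that is equally likely to lie in each of the $n+1$ gaps, is $\sim \frac{1}{H(t)}\ln n$. 2. The expected number of elements rebalanced in the cleanup after an insertion into a uniformly random one of the $n+1$ gaps is $\sim\frac{k}{H(t)}\ln n$. 3. The expected number of elements rebalanced in the cleanup after the deletion of a uniformly random one of the $n$ keys is $\sim\frac{k}{H(t)}\ln n$. 4. The expected fraction of jump nodes among all nodes is asymptotically at most $\frac{1}{(w+1)H(t)}$, that is, its limit superior is at most this number. Consequently, if a plain node takes $1$ machine word and a jump node $3$ machine words in addition to the key, then the expected number of additional words per key has limit superior at most $1+\frac{2}{(w+1)H(t)}$. -/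

import Mathlib

open Filter Asymptotics Topology
open scoped NNReal ENNReal

noncomputable section

/-! ### Jumplists

Only the pointer configuration of a jumplist matters. A list whose nodes are all plain is
`plain m`, with `m` the number of nodes (header included). A list whose header `v₀` is a jump node
consists of `v₀`, followed by the next-sublist, followed by the jump-sublist; the jump pointer of
`v₀` leads to the head of the jump-sublist. -/

inductive Jumplist : Type
  | plain (m : ℕ) : Jumplist
  | jump (next jump : Jumplist) : Jumplist
  deriving DecidableEq

namespace Jumplist

/-- The number of nodes, including the dummy header. -/
def nodes : Jumplist → ℕ
  | plain m => m
  | jump A B => 1 + A.nodes + B.nodes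

/-- The number of jump nodes. -/
def jumpNodes : Jumplist → ℕ
  | plain _ => 0
  | jump A B => 1 + A.jumpNodes + B.jumpNodes

/-- The number of machine words needed on top of the keys: one (`next`) for every plain node,
three (`next`, `jump`, `nsize`) for every jump node. -/
def words : Jumplist → ℕ
  | plain m => m
  | jump A B => 3 + A.words + B.words

/-- All legal pointer configurations on `m` nodes with leaf size `w`: all nodes are plain if
`m ≤ w`; otherwise the header is a jump node, and next- and jump-sublist are legal and nonempty
(of sizes `i + 1` and `m - 2 - i`, with `i < m - 2`). -/
def configs (w : ℕ) : ℕ → Finset Jumplist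
  | m =>
    if m ≤ w then {plain m}
    else (Finset.univ : Finset (Fin (m - 2))).biUnion fun i =>
      (configs w (i.1 + 1) ×ˢ configs w (m - 2 - i.1)).image fun P => jump P.1 P.2
  termination_by m => m
  decreasing_by all_goals (have := i.2; omega)

/-- The probability of a legal configuration in the median-of-`(2t+1)` model:
`C(J₁-1, t) C(J₂-1, t) / C(m-2, 2t+1) * p(𝒥₁) * p(𝒥₂)` where `m = 1 + J₁ + J₂`. -/
def prob (t : ℕ) : Jumplist → ℝ≥0
  | plain _ => 1
  | jump A B =>
    ((A.nodes - 1).choose t * (B.nodes - 1).choose t : ℝ≥0) /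
      ((A.nodes + B.nodes - 1).choose (2 * t + 1) : ℝ≥0) * prob t A * prob t B

theorem nodes_of_mem_configs {w : ℕ} : ∀ (m : ℕ) (J : Jumplist), J ∈ configs w m → J.nodes = m := by
  intro m
  induction m using Nat.strong_induction_on with
  | _ m ih =>
    intro J hJ
    rw [configs] at hJ
    split_ifs at hJ with hm
    · rw [Finset.mem_singleton.1 hJ, nodes]
    · simp only [Finset.mem_biUnion, Finset.mem_univ, true_and, Finset.mem_image,
        Finset.mem_product] at hJ
      obtain ⟨i, ⟨A, B⟩, ⟨hA, hB⟩, rfl⟩ := hJ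
      have hi := i.2
      have h1 := ih (i.1 + 1) (by omega) A hA
      have h2 := ih (m - 2 - i.1) (by omega) B hB
      simp only [nodes]
      omega

theorem sum_choose_mul_choose (a b n : ℕ) :
    ∑ i ∈ Finset.range n, i.choose a * (n - 1 - i).choose b = n.choose (a + b + 1) := by
  induction n generalizing b with
  | zero => simp
  | succ n ih =>
    rw [Finset.sum_range_succ]
    cases b with
    | zero =>
      have := ih 0
      simp only [Nat.choose_zero_right, mul_one, add_zero] at this ⊢
      rw [this, Nat.choose_succ_succ]
      ring
    | succ b =>
      have h : ∀ i ∈ Finset.range n, i.choose a * (n + 1 - 1 - i).choose (b + 1) =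
          i.choose a * (n - 1 - i).choose b + i.choose a * (n - 1 - i).choose (b + 1) := by
        intro i hi
        have hi := Finset.mem_range.1 hi
        have e : n + 1 - 1 - i = (n - 1 - i) + 1 := by omega
        rw [e, Nat.choose_succ_succ]
        ring
      rw [Finset.sum_congr rfl h, Finset.sum_add_distrib, ih b, ih (b + 1)]
      have e : a + (b + 1) + 1 = (a + b + 1) + 1 := by ring
      rw [e, Nat.choose_succ_succ]
      simp

theorem sum_prob_configs {w t : ℕ} (hw : 2 * t + 2 ≤ w) (m : ℕ) :
    ∑ J ∈ configs w m, prob t J = 1 := by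
  induction m using Nat.strong_induction_on with
  | _ m ih =>
    rw [configs]
    split_ifs with hm
    · simp [prob]
    · rw [Finset.sum_biUnion]
      · have key : ∀ i : Fin (m - 2),
            ∑ J ∈ (configs w (i.1 + 1) ×ˢ configs w (m - 2 - i.1)).image
              (fun P => jump P.1 P.2), prob t J =
            ((i.1.choose t * (m - 2 - 1 - i.1).choose t : ℕ) : ℝ≥0) /
              ((m - 2).choose (2 * t + 1) : ℝ≥0) := by
          intro i
          have hi := i.2
          rw [Finset.sum_image (by rintro ⟨A, B⟩ - ⟨C, D⟩ - h; simpa using h),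
            Finset.sum_product]
          have : ∀ A ∈ configs w (i.1 + 1), ∀ B ∈ configs w (m - 2 - i.1),
              prob t (jump A B) = ((i.1.choose t * (m - 2 - 1 - i.1).choose t : ℕ) : ℝ≥0) /
              ((m - 2).choose (2 * t + 1) : ℝ≥0) * (prob t A * prob t B) := by
            intro A hA B hB
            rw [prob, nodes_of_mem_configs _ _ hA, nodes_of_mem_configs _ _ hB]
            have e1 : i.1 + 1 - 1 = i.1 := by omega
            have e2 : m - 2 - i.1 - 1 = m - 2 - 1 - i.1 := by omega
            have e3 : i.1 + 1 + (m - 2 - i.1) - 1 = m - 2 := by omega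
            rw [e1, e2, e3]
            push_cast
            ring
          rw [Finset.sum_congr rfl fun A hA => Finset.sum_congr rfl fun B hB => this A hA B hB]
          simp_rw [← Finset.mul_sum]
          rw [ih _ (by omega)]
          simp only [mul_one]
          rw [ih _ (by omega), mul_one]
        rw [Finset.sum_congr rfl fun i _ => key i, ← Finset.sum_div, ← Nat.cast_sum,
          Fin.sum_univ_eq_sum_range (fun i => i.choose t * (m - 2 - 1 - i).choose t) (m - 2),
          sum_choose_mul_choose]
        have e : t + t + 1 = 2 * t + 1 := by ring
        rw [e]
        apply div_self
        have : 0 < (m - 2).choose (2 * t + 1) := Nat.choose_pos (by omega)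
        exact_mod_cast this.ne'
      · intro i _ j _ hij
        rw [Function.onFun, Finset.disjoint_left]
        intro J h1 h2
        simp only [Finset.mem_image, Finset.mem_product] at h1 h2
        obtain ⟨P, ⟨hP, -⟩, rfl⟩ := h1
        obtain ⟨Q, ⟨hQ, -⟩, h⟩ := h2
        have hA : Q.1 = P.1 := (jump.inj h).1
        have := nodes_of_mem_configs _ _ hP
        rw [← hA, nodes_of_mem_configs _ _ hQ] at this
        exact hij (Fin.ext (by omega))

/-- The random median-of-`(2t+1)` jumplist with leaf size `w ≥ 2t+2` on `m` nodes: every legal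
configuration `J` has probability `prob t J`. -/
def random (w t : ℕ) (hw : 2 * t + 2 ≤ w) (m : ℕ) : PMF Jumplist :=
  PMF.ofFinset (fun J => if J ∈ configs w m then (prob t J : ℝ≥0∞) else 0) (configs w m)
    (by
      rw [Finset.sum_congr rfl fun J hJ => if_pos hJ, ← ENNReal.ofNNReal_finsetSum,
        sum_prob_configs hw, ENNReal.coe_one])
    (fun _ hJ => if_neg hJ)

/-! ### Spine search

The list has nodes `v₀, v₁, …, vₙ`; the key of `vᵢ` is `i` for `1 ≤ i ≤ n`, and a sentinel with
key `+∞` follows `vₙ`. -/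

/-- The first phase of spine search for `x` in the sublist that starts at node `v_head`, the last
node jumped to being `v_last`. Returns the index of the last node jumped to when a plain node is
reached, and the number of key comparisons. -/
def bstPhase (x : ℚ) : Jumplist → (head last : ℕ) → ℕ × ℕ
  | plain _, _, last => (last, 0)
  | jump A B, head, last =>
    let target := head + 1 + A.nodes
    if (target : ℚ) < x then
      let r := bstPhase x B target target
      (r.1, r.2 + 1)
    else
      let r := bstPhase x A (head + 1) last
      (r.1, r.2 + 1)

/-- The number of key comparisons of the linear search for `x` that starts at node `v_pos` when
`rest` nodes (not counting the sentinel) follow it. -/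
def linearPhase (x : ℚ) : (rest pos : ℕ) → ℕ
  | 0, _ => 1
  | rest + 1, pos => if ((pos + 1 : ℕ) : ℚ) < x then linearPhase x rest (pos + 1) + 1 else 1

/-- The number of key comparisons of a spine search for `x` in the whole jumplist. -/
def spineSearchCost (x : ℚ) (J : Jumplist) : ℕ :=
  let r := bstPhase x J 0 0
  r.2 + linearPhase x (J.nodes - 1 - r.1) r.1

/-! ### Cleanup after insertion and after deletion -/

/-- A biased coin, `true` with probability `p` (truncated at `1`). -/
def coin (p : ℝ≥0) : PMF Bool :=
  PMF.ofFintype (fun b => if b then ((min p 1 : ℝ≥0) : ℝ≥0∞) else ((1 - min p 1 : ℝ≥0) : ℝ≥0∞))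
    (by
      rw [Fintype.sum_bool, if_pos rfl, if_neg (by simp), ← ENNReal.coe_add,
        add_tsub_cancel_of_le (min_le_right p 1), ENNReal.coe_one])

/-- The (random) number of elements rebalanced by the cleanup after a new node has been inserted
with rank `r` into the given sublist (so that `r` of its nodes precede the new node). If the
list, new node included, has at most `w` nodes, then nothing is done; if it has `w + 1`, it is
rebalanced. If it has `m > w + 1` nodes, it is rebalanced with probability `k / (m - 2)`,
`k = 2t+1`; otherwise the topmost jump pointer is kept and the cleanup continues in the sublist
that contains the new node. (If `r = 0`, the new node takes over the jump pointer of the old header,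
which is then treated as the new header of the next-sublist.) At most one rebalancing takes place,
and it ends the cleanup. -/
def insertCost (w t : ℕ) : Jumplist → ℕ → PMF ℕ
  | plain m₀, _ => PMF.pure (if m₀ + 1 = w + 1 then m₀ + 1 else 0)
  | jump A B, r =>
    let m := (jump A B).nodes + 1
    (coin ((2 * t + 1 : ℕ) / (m - 2 : ℕ))).bind fun rebalance =>
      if rebalance then PMF.pure m
      else if r ≤ A.nodes + 1 then insertCost w t A (r - 1)
      else insertCost w t B (r - 1 - A.nodes)

/-- The probability that deleting the node of rank `r` (the header has rank `0`) forces a list to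
be rebalanced whose next- and jump-sublist have sizes `J₁` and `J₂` before the deletion. -/
def deleteProb (t J₁ J₂ r : ℕ) : ℝ≥0 :=
  if r = J₁ + 1 then 1
  else if r < J₁ + 1 then
    if t = 0 ∧ J₁ = 1 then 1 else (t : ℝ≥0) / (J₁ - 1 : ℕ)
  else (t : ℝ≥0) / (J₂ - 1 : ℕ)

/-- The (random) number of elements rebalanced by the cleanup after the node of rank `r` has been
deleted from the given sublist. If a list of plain nodes remains a list of plain nodes, then nothing
is done. If a list with a jump pointer shrinks to `m = w` nodes, then its header is turned into a
plain node, which counts as one rebalanced element. If it shrinks to `m > w` nodes, then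
with probability `deleteProb` it is rebalanced, which ends the cleanup; otherwise the
topmost jump pointer is kept and the cleanup continues in the sublist that contained the deleted
node. (If `r = 0`, the head of the next-sublist takes over the jump pointer of the deleted header,
and the cleanup continues as if the head of the next-sublist had been deleted.) -/
def deleteCost (w t : ℕ) : Jumplist → ℕ → PMF ℕ
  | plain _, _ => PMF.pure 0
  | jump A B, r =>
    let m := (jump A B).nodes - 1
    if m ≤ w then PMF.pure 1
    else (coin (deleteProb t A.nodes B.nodes r)).bind fun rebalance =>
      if rebalance then PMF.pure m
      else if r < A.nodes + 1 then deleteCost w t A (r - 1)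
      else deleteCost w t B (r - 1 - A.nodes)

/-! ### Expected costs on `n` keys (`n + 1` nodes) -/

/-- The mean of a distribution on `ℕ`. All distributions below have finite support. -/
def mean (p : PMF ℕ) : ℝ := (∑' c : ℕ, p c * (c : ℝ≥0∞)).toReal

/-- The expected number of key comparisons of a spine search for a number that is equally likely
to lie in each of the `n + 1` gaps, that is, for one of `0.5, 1.5, …, n + 0.5`. -/
def expectedSpineSearch (w t : ℕ) (hw : 2 * t + 2 ≤ w) (n : ℕ) : ℝ :=
  (∑ g ∈ Finset.range (n + 1),
    mean ((random w t hw (n + 1)).map (spineSearchCost ((g : ℚ) + 1 / 2)))) / (n + 1)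

/-- The expected number of elements rebalanced after an insertion, where the rank of the new node
is uniform on `{1, …, n + 1}` (nothing is inserted before the dummy header). -/
def expectedInsert (w t : ℕ) (hw : 2 * t + 2 ≤ w) (n : ℕ) : ℝ :=
  (∑ r ∈ Finset.Icc 1 (n + 1),
    mean ((random w t hw (n + 1)).bind fun J => insertCost w t J r)) / (n + 1)

/-- The expected number of elements rebalanced after a deletion, where the rank of the deleted node
is uniform on `{1, …, n}` (the dummy header is not deleted). -/
def expectedDelete (w t : ℕ) (hw : 2 * t + 2 ≤ w) (n : ℕ) : ℝ :=
  (∑ r ∈ Finset.Icc 1 n,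
    mean ((random w t hw (n + 1)).bind fun J => deleteCost w t J r)) / n

/-- The expected fraction of jump nodes among the `n + 1` nodes. -/
def expectedJumpFraction (w t : ℕ) (hw : 2 * t + 2 ≤ w) (n : ℕ) : ℝ :=
  mean ((random w t hw (n + 1)).map jumpNodes) / (n + 1)

/-- The expected number of additional machine words per key. -/
def expectedWordsPerKey (w t : ℕ) (hw : 2 * t + 2 ≤ w) (n : ℕ) : ℝ :=
  mean ((random w t hw (n + 1)).map words) / n

end Jumplist

/-- `H(t) = H_{k+1} - H_{t+1}` with `k = 2t+1` and `H_n` the harmonic numbers. -/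
def harmonicGap (t : ℕ) : ℝ := ((harmonic (2 * t + 2) - harmonic (t + 1) : ℚ) : ℝ)

end

/-!
All quantities are indexed by the number `n` of keys. A functional of a jumplist that is a toll plus
separate contributions of the two sublists has a mean `u` with
`u (n + 1) = toll + 2 * medianMean t u n`, where `medianMean t f n` is the mean of `f` at the median
of a random `(2t+1)`-subset of `{0, …, n - 1}` (`expect_of_additive`).

Search, insertion and deletion. The total cost over all gaps (or keys) satisfies such a recurrence
with a toll `∼ κ n`, where `κ = 1` for spine search and `κ = 2t+1` for the cleanups. The other
contributions to the toll depend on the leftmost branch only, or carry a rebalancing probability of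
order `1 / n`, and are negligible. Size biasing turns the median into another order statistic, at
which the harmonic numbers have an explicit mean (`sum_choose_mul_choose_mul_harm`), so that
`(n + 1) H_{n+1}` solves the recurrence exactly with a toll `∼ harmonicGap t * n`. Its multiples,
plus linear terms, are therefore super- and subsolutions, and `tendsto_of_toll` yields the total
`∼ κ / harmonicGap t * n log n`.

Jump nodes. Here the toll is `1` and the mean `y` grows linearly. By stochastic monotonicity `y` is
increasing, which makes `b n = y n / (n + 1)` subharmonic, up to `1 / (n + 1)`, for the Markov chain
`stepProb t` of size-biased sublist sizes. This chain has the invariant measure `1 / (n + 2)`. The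
flow of this measure from above `m` to the states up to `m` has an explicit form (`flow`), and its
total is `harmonicGap t` for every large `m` (`sum_flow`). The average of `b` under the flow grows by
at most `1 / ((n + 1) (n + 2))` at level `n ≥ w`, so it stays below `1 / (w + 1)` (`sum_flow_mul_le`).
Where `b` comes close to its limit superior, subharmonicity forces it to be almost constant on the
states below, hence the limit superior is at most `1 / ((w + 1) * harmonicGap t)`
(`limsup_le_of_subharmonic`).
-/

namespace Jumplist

/-! ### Harmonic numbers and the median of a random sample -/

/-- The harmonic number `H_n` as a real number. -/
noncomputable def harm (n : ℕ) : ℝ := (harmonic n : ℝ)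

@[simp] theorem harm_zero : harm 0 = 0 := by simp [harm]

theorem harm_succ (n : ℕ) : harm (n + 1) = harm n + 1 / (n + 1 : ℝ) := by
  simp [harm, harmonic_succ]

theorem harm_mono : Monotone harm :=
  monotone_nat_of_le_succ fun n => by
    rw [harm_succ]
    have : (0 : ℝ) ≤ 1 / (n + 1 : ℝ) := by positivity
    linarith

theorem harm_nonneg (n : ℕ) : 0 ≤ harm n := by
  simpa using harm_mono (Nat.zero_le n)

theorem one_le_harm_succ (n : ℕ) : 1 ≤ harm (n + 1) := by
  have := harm_mono (show 1 ≤ n + 1 by omega)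
  rwa [show harm 1 = 1 by simpa using harm_succ 0] at this

theorem harm_lt {a b : ℕ} (h : a < b) : harm a < harm b := by
  have h1 := harm_mono (show a + 1 ≤ b by omega)
  have h2 := harm_succ a
  have : (0 : ℝ) < 1 / (a + 1 : ℝ) := by positivity
  linarith

theorem harmonicGap_eq (t : ℕ) : harmonicGap t = harm (2 * t + 2) - harm (t + 1) := by
  simp [harmonicGap, harm]

theorem harmonicGap_pos (t : ℕ) : 0 < harmonicGap t := by
  rw [harmonicGap_eq]
  have := harm_lt (show t + 1 < 2 * t + 2 by omega)
  linarith

theorem tendsto_harm_atTop : Tendsto harm atTop atTop := by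
  have h1 : Tendsto (fun n : ℕ => harm n - Real.log n) atTop (𝓝 Real.eulerMascheroniConstant) :=
    Real.tendsto_harmonic_sub_log
  have h2 : Tendsto (fun n : ℕ => Real.log n) atTop atTop :=
    Real.tendsto_log_atTop.comp tendsto_natCast_atTop_atTop
  have := h1.add_atTop h2
  simpa using this

theorem tendsto_harm_div_log : Tendsto (fun n : ℕ => harm n / Real.log n) atTop (𝓝 1) := by
  have h1 : Tendsto (fun n : ℕ => harm n - Real.log n) atTop (𝓝 Real.eulerMascheroniConstant) :=
    Real.tendsto_harmonic_sub_log
  have h2 : Tendsto (fun n : ℕ => Real.log n) atTop atTop :=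
    Real.tendsto_log_atTop.comp tendsto_natCast_atTop_atTop
  have h3 := (h1.div_atTop h2).add_const 1
  rw [zero_add] at h3
  refine h3.congr' ?_
  filter_upwards [h2.eventually_gt_atTop 0] with n hn
  field_simp
  ring

theorem tendsto_harm_div : Tendsto (fun n : ℕ => harm n / (n : ℝ)) atTop (𝓝 0) := by
  have h1 : Tendsto (fun n : ℕ => Real.log n / (n : ℝ)) atTop (𝓝 0) :=
    (Real.isLittleO_log_id_atTop.tendsto_div_nhds_zero).comp tendsto_natCast_atTop_atTop
  have h2 := tendsto_harm_div_log.mul h1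
  rw [mul_zero] at h2
  refine h2.congr' ?_
  filter_upwards [eventually_gt_atTop 1] with n hn
  have : 0 < Real.log n := Real.log_pos (by exact_mod_cast hn)
  field_simp

/-- The mean of `H_M` when `M` is the number of elements of `{0, …, N - 1}` below the
`(a + 1)`-st smallest element of a random subset with `a + b + 1` elements, with denominators
cleared. -/
theorem sum_choose_mul_choose_mul_harm (a b N : ℕ) :
    ∑ i ∈ Finset.range N, (i.choose a * (N - 1 - i).choose b : ℝ) * harm i =
      N.choose (a + b + 1) * (harm N - harm (a + b + 1) + harm a) := by
  induction N generalizing b with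
  | zero => simp
  | succ N ih =>
    have hp : ∀ c : ℕ, ((N + 1).choose (c + 1) : ℝ) = N.choose c + N.choose (c + 1) := by
      intro c; exact_mod_cast Nat.choose_succ_succ N c
    have habs : ∀ c : ℕ, ((N + 1).choose (c + 1) : ℝ) / (N + 1) = N.choose c / (c + 1) := by
      intro c
      have h : ((N + 1 : ℕ) : ℝ) * N.choose c = (N + 1).choose (c + 1) * ((c + 1 : ℕ) : ℝ) := by
        exact_mod_cast Nat.add_one_mul_choose_eq N c
      push_cast at h
      rw [div_eq_div_iff (by positivity) (by positivity)]
      linarith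
    rw [Finset.sum_range_succ]
    cases b with
    | zero =>
      have := ih 0
      simp only [Nat.choose_zero_right, Nat.cast_one, mul_one, add_zero] at this ⊢
      have h1 := habs a
      rw [this, harm_succ N, harm_succ a]
      have e : ((N + 1).choose (a + 1) : ℝ) *
          (harm N + 1 / (N + 1) - (harm a + 1 / (a + 1)) + harm a) =
          (N + 1).choose (a + 1) * (harm N - 1 / (a + 1)) + (N + 1).choose (a + 1) / (N + 1) := by
        ring
      rw [e, h1, hp a]
      ring
    | succ b =>
      have h : ∀ i ∈ Finset.range N, (i.choose a * (N + 1 - 1 - i).choose (b + 1) : ℝ) * harm i =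
          (i.choose a * (N - 1 - i).choose b : ℝ) * harm i +
            (i.choose a * (N - 1 - i).choose (b + 1) : ℝ) * harm i := by
        intro i hi
        have hi := Finset.mem_range.1 hi
        have e : N + 1 - 1 - i = (N - 1 - i) + 1 := by omega
        rw [e, Nat.choose_succ_succ]
        push_cast
        ring
      rw [Finset.sum_congr rfl h, Finset.sum_add_distrib, ih b, ih (b + 1)]
      have e : a + (b + 1) + 1 = (a + b + 1) + 1 := by ring
      have h1 := habs (a + b + 1)
      rw [e, harm_succ N, harm_succ (a + b + 1)]
      have e2 : ((N + 1).choose (a + b + 1 + 1) : ℝ) *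
          (harm N + 1 / (N + 1) - (harm (a + b + 1) + 1 / ((a + b + 1 : ℕ) + 1 : ℝ)) + harm a) =
          (N + 1).choose (a + b + 1 + 1) *
            (harm N - (harm (a + b + 1) + 1 / ((a + b + 1 : ℕ) + 1 : ℝ)) + harm a) +
          (N + 1).choose (a + b + 1 + 1) / (N + 1) := by
        ring
      rw [e2, h1, hp]
      simp only [Nat.add_sub_cancel, Nat.sub_self, Nat.choose_zero_succ, Nat.cast_zero, mul_zero,
        zero_mul]
      ring

/-- The probability that the median of a random `(2t+1)`-subset of `{0, …, N - 1}` is `i`. The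
sublists of a random jumplist with `N + 2` nodes have `i + 1` and `N - i` nodes with this
probability. -/
noncomputable def split (t N i : ℕ) : ℝ :=
  (i.choose t * (N - 1 - i).choose t : ℝ) / N.choose (2 * t + 1)

theorem split_nonneg (t N i : ℕ) : 0 ≤ split t N i := by unfold split; positivity

/-- The mean of `f` at the median of a random `(2t+1)`-subset of `{0, …, N - 1}`. -/
noncomputable def medianMean (t : ℕ) (f : ℕ → ℝ) (N : ℕ) : ℝ :=
  ∑ i ∈ Finset.range N, split t N i * f i

section medianMean

variable {t N : ℕ} {f g : ℕ → ℝ}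

theorem choose_pos_real (h : 2 * t + 1 ≤ N) : (0 : ℝ) < N.choose (2 * t + 1) := by
  exact_mod_cast Nat.choose_pos h

theorem sum_split (h : 2 * t + 1 ≤ N) : ∑ i ∈ Finset.range N, split t N i = 1 := by
  unfold split
  have h1 := choose_pos_real h
  rw [← Finset.sum_div, div_eq_one_iff_eq h1.ne']
  have := sum_choose_mul_choose t t N
  rw [show t + t + 1 = 2 * t + 1 by ring] at this
  exact_mod_cast this

theorem medianMean_mono (hfg : ∀ i < N, f i ≤ g i) : medianMean t f N ≤ medianMean t g N :=
  Finset.sum_le_sum fun i hi =>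
    mul_le_mul_of_nonneg_left (hfg i (Finset.mem_range.1 hi)) (split_nonneg _ _ _)

theorem medianMean_nonneg (hf : ∀ i < N, 0 ≤ f i) : 0 ≤ medianMean t f N :=
  Finset.sum_nonneg fun i hi => mul_nonneg (split_nonneg _ _ _) (hf i (Finset.mem_range.1 hi))

theorem medianMean_add : medianMean t (fun i => f i + g i) N =
    medianMean t f N + medianMean t g N := by
  simp [medianMean, mul_add, Finset.sum_add_distrib]

theorem medianMean_sub : medianMean t (fun i => f i - g i) N =
    medianMean t f N - medianMean t g N := by
  simp [medianMean, mul_sub, Finset.sum_sub_distrib]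

theorem medianMean_const_mul (c : ℝ) : medianMean t (fun i => c * f i) N =
    c * medianMean t f N := by
  simp only [medianMean, Finset.mul_sum]
  exact Finset.sum_congr rfl fun i _ => by ring

theorem medianMean_const (h : 2 * t + 1 ≤ N) (c : ℝ) : medianMean t (fun _ => c) N = c := by
  simp [medianMean, ← Finset.sum_mul, sum_split h]

theorem medianMean_reflect :
    ∑ i ∈ Finset.range N, split t N i * f (N - 1 - i) = medianMean t f N := by
  rw [medianMean, ← Finset.sum_range_reflect]
  refine Finset.sum_congr rfl fun i hi => ?_
  have hi := Finset.mem_range.1 hi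
  have e : N - 1 - (N - 1 - i) = i := by omega
  simp only [split, e]
  ring

/-- Size biasing turns the median of a random `(2t+1)`-subset of `{0, …, N - 1}` into the
`(t+2)`-nd smallest element of a random `(2t+2)`-subset of `{0, …, N}`. -/
theorem two_mul_split_mul (i : ℕ) (hN : 2 * t + 1 ≤ N) :
    2 * (split t N i * (i + 1)) =
      (N + 1) * (((i + 1).choose (t + 1) * (N - 1 - i).choose t : ℝ) /
        (N + 1).choose (2 * t + 2)) := by
  have h1 : ((i + 1 : ℕ) : ℝ) * i.choose t = (i + 1).choose (t + 1) * ((t + 1 : ℕ) : ℝ) := by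
    exact_mod_cast Nat.add_one_mul_choose_eq i t
  have h2 : ((N + 1 : ℕ) : ℝ) * N.choose (2 * t + 1) =
      (N + 1).choose (2 * t + 2) * ((2 * t + 2 : ℕ) : ℝ) := by
    exact_mod_cast Nat.add_one_mul_choose_eq N (2 * t + 1)
  have h3 := choose_pos_real hN
  have h4 : (0 : ℝ) < (N + 1).choose (2 * t + 2) := by
    exact_mod_cast Nat.choose_pos (by omega)
  push_cast at h1 h2
  unfold split
  rw [← sub_eq_zero]
  field_simp
  have e : (N + 1 : ℝ) * (i + 1).choose (t + 1) * (N.choose (2 * t + 1)) =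
    (i + 1).choose (t + 1) * ((N + 1).choose (2 * t + 2) * (2 * t + 2)) := by rw [← h2]; ring
  have e2 : (2 : ℝ) * i.choose t * (i + 1) = (i + 1).choose (t + 1) * (2 * t + 2) := by
    linear_combination 2 * h1
  linear_combination ((N - 1 - i).choose t : ℝ) * (((N + 1).choose (2 * t + 2) : ℝ) * e2 - e)

theorem sum_range_shift_choose (F : ℕ → ℝ) :
    ∑ i ∈ Finset.range N, ((i + 1).choose (t + 1) * (N - 1 - i).choose t : ℝ) * F (i + 1) =
    ∑ i ∈ Finset.range (N + 1), (i.choose (t + 1) * (N + 1 - 1 - i).choose t : ℝ) * F i := by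
  rw [Finset.sum_range_succ']
  simp only [Nat.choose_zero_succ, Nat.cast_zero, zero_mul, add_zero]
  refine Finset.sum_congr rfl fun i _ => ?_
  rw [show N + 1 - 1 - (i + 1) = N - 1 - i by omega]

theorem sum_choose_succ_mul_choose : ∑ i ∈ Finset.range N,
    ((i + 1).choose (t + 1) * (N - 1 - i).choose t : ℝ) = (N + 1).choose (2 * t + 2) := by
  have h := sum_range_shift_choose (t := t) (N := N) (fun _ => 1)
  simp only [mul_one] at h
  rw [h]
  have := sum_choose_mul_choose (t + 1) t (N + 1)
  rw [show t + 1 + t + 1 = 2 * t + 2 by ring] at this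
  exact_mod_cast this

theorem two_mul_medianMean_succ (hN : 2 * t + 1 ≤ N) :
    2 * medianMean t (fun i => (i : ℝ) + 1) N = N + 1 := by
  have h4 : (0 : ℝ) < (N + 1).choose (2 * t + 2) := by
    exact_mod_cast Nat.choose_pos (by omega)
  rw [medianMean, Finset.mul_sum, Finset.sum_congr rfl fun i _ => two_mul_split_mul i hN,
    ← Finset.mul_sum, ← Finset.sum_div, sum_choose_succ_mul_choose, div_self h4.ne', mul_one]

theorem two_mul_medianMean_succ_mul_harm (hN : 2 * t + 1 ≤ N) :
    2 * medianMean t (fun i => ((i : ℝ) + 1) * harm (i + 1)) N =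
      (N + 1) * (harm (N + 1) - harmonicGap t) := by
  have h4 : (0 : ℝ) < (N + 1).choose (2 * t + 2) := by
    exact_mod_cast Nat.choose_pos (by omega)
  have h : ∀ i ∈ Finset.range N, 2 * (split t N i * (((i : ℝ) + 1) * harm (i + 1))) =
      (N + 1) * ((((i + 1).choose (t + 1) * (N - 1 - i).choose t : ℝ) * harm (i + 1)) /
        (N + 1).choose (2 * t + 2)) := by
    intro i _
    have := two_mul_split_mul i hN
    linear_combination harm (i + 1) * this
  rw [medianMean, Finset.mul_sum, Finset.sum_congr rfl h, ← Finset.mul_sum, ← Finset.sum_div,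
    sum_range_shift_choose, sum_choose_mul_choose_mul_harm, harmonicGap_eq,
    show t + 1 + t + 1 = 2 * t + 2 by ring]
  field_simp
  ring

theorem medianMean_harm (hN : 2 * t + 1 ≤ N) :
    medianMean t harm N = harm N - (harm (2 * t + 1) - harm t) := by
  have h1 := choose_pos_real hN
  have h : ∀ i ∈ Finset.range N, split t N i * harm i =
      (i.choose t * (N - 1 - i).choose t : ℝ) * harm i / N.choose (2 * t + 1) := by
    intro i _; unfold split; ring
  rw [medianMean, Finset.sum_congr rfl h, ← Finset.sum_div, sum_choose_mul_choose_mul_harm,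
    show t + t + 1 = 2 * t + 1 by ring]
  field_simp
  ring

end medianMean

/-! ### The transfer theorem -/

/-- Every sequence is bounded on an initial segment. -/
theorem exists_nonneg_bound (f : ℕ → ℝ) (n₀ : ℕ) : ∃ K : ℝ, 0 ≤ K ∧ ∀ n ≤ n₀, f n ≤ K := by
  refine ⟨∑ i ∈ Finset.range (n₀ + 1), |f i|, Finset.sum_nonneg fun _ _ => abs_nonneg _,
    fun n hn => (le_abs_self _).trans ?_⟩
  exact Finset.single_le_sum (f := fun i => |f i|) (fun _ _ => abs_nonneg _)
    (Finset.mem_range.2 (by omega))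

/-- Comparison principle for the recurrence `u (n + 1) = toll + c * medianMean t u n`. -/
theorem le_of_supersolution {t n₀ : ℕ} {c : ℝ} (hc : 0 ≤ c) {u φ : ℕ → ℝ}
    (h0 : ∀ n ≤ n₀, u n ≤ φ n)
    (hstep : ∀ n, n₀ ≤ n → u (n + 1) - c * medianMean t u n ≤ φ (n + 1) - c * medianMean t φ n) :
    ∀ n, u n ≤ φ n := by
  intro n
  induction n using Nat.strong_induction_on with
  | _ n ih =>
    by_cases hn : n ≤ n₀
    · exact h0 n hn
    · obtain ⟨n, rfl⟩ : ∃ k, n = k + 1 := ⟨n - 1, by omega⟩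
      have h1 := hstep n (by omega)
      have h2 : medianMean t u n ≤ medianMean t φ n :=
        medianMean_mono fun i hi => ih i (by omega)
      have h3 := mul_le_mul_of_nonneg_left h2 hc
      linarith

/-- A toll of linear order leads to a total of order at most `n * log n`. -/
theorem exists_le_mul_harm {t n₀ : ℕ} {u : ℕ → ℝ} {C : ℝ} (hn₀ : 2 * t + 1 ≤ n₀)
    (hu : ∀ n, n₀ ≤ n → u (n + 1) - 2 * medianMean t u n ≤ C * (n + 1)) :
    ∃ K : ℝ, 0 ≤ K ∧ ∀ n, u n ≤ K * ((n + 1) * harm (n + 1)) := by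
  obtain ⟨K₀, hK₀, hK⟩ := exists_nonneg_bound u n₀
  have hH := harmonicGap_pos t
  have hKC : 0 ≤ K₀ + |C| / harmonicGap t := by positivity
  refine ⟨K₀ + |C| / harmonicGap t, hKC,
    le_of_supersolution (t := t) (n₀ := n₀) zero_le_two ?_ ?_⟩
  · intro n hn
    have h1 := one_le_harm_succ n
    have h2 : (1 : ℝ) ≤ (n + 1) * harm (n + 1) := by
      have : (0 : ℝ) ≤ n := n.cast_nonneg
      nlinarith
    have h3 : 0 ≤ |C| / harmonicGap t := by positivity
    have h4 := hK n hn
    nlinarith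
  · intro n hn
    refine (hu n hn).trans ?_
    have h1 := two_mul_medianMean_succ_mul_harm (t := t) (N := n) (by omega)
    rw [medianMean_const_mul]
    have h2 : harm (n + 1 + 1) ≥ harm (n + 1) := harm_mono (by omega)
    have h3 := one_le_harm_succ n
    have h0 : (0 : ℝ) ≤ n := n.cast_nonneg
    have h4 : ((n : ℝ) + 1) * harmonicGap t ≤ ((n + 1 : ℕ) + 1 : ℝ) * harm (n + 1 + 1) -
        2 * medianMean t (fun i => ((i : ℝ) + 1) * harm (i + 1)) n := by
      rw [h1]; push_cast; nlinarith
    have h5 := mul_le_mul_of_nonneg_left h4 hKC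
    have h6 : C * (n + 1) ≤ (K₀ + |C| / harmonicGap t) * ((n + 1) * harmonicGap t) := by
      have e : (K₀ + |C| / harmonicGap t) * ((n + 1) * harmonicGap t) =
          K₀ * ((n + 1) * harmonicGap t) + |C| * (n + 1) := by field_simp
      rw [e]
      have := le_abs_self C
      have : 0 ≤ K₀ * ((n + 1) * harmonicGap t) := by positivity
      nlinarith
    linarith

/-- Quantities that follow only the leftmost branch grow at most logarithmically. -/
theorem exists_le_harm_add_one {t n₀ : ℕ} {l : ℕ → ℝ} {C : ℝ} (hn₀ : 2 * t + 1 ≤ n₀)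
    (hl : ∀ n, n₀ ≤ n → l (n + 1) - medianMean t l n ≤ C) :
    ∃ K : ℝ, 0 ≤ K ∧ ∀ n, l n ≤ K * (harm n + 1) := by
  obtain ⟨K₀, hK₀, hK⟩ := exists_nonneg_bound l n₀
  have hh : 0 < harm (2 * t + 1) - harm t := by
    have := harm_lt (show t < 2 * t + 1 by omega)
    linarith
  set h := harm (2 * t + 1) - harm t with hdef
  have hKC : 0 ≤ K₀ + |C| / h := by positivity
  refine ⟨K₀ + |C| / h, hKC, le_of_supersolution (t := t) (n₀ := n₀) zero_le_one ?_ ?_⟩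
  · intro n hn
    have h1 := harm_nonneg n
    have h3 : 0 ≤ |C| / h := by positivity
    have h4 := hK n hn
    nlinarith
  · intro n hn
    have h0 := hl n hn
    rw [medianMean_const_mul, medianMean_add, medianMean_const (by omega),
      medianMean_harm (by omega), ← hdef]
    have h2 : harm (n + 1) ≥ harm n := harm_mono (by omega)
    have h6 : C ≤ (K₀ + |C| / h) * h := by
      have e : (K₀ + |C| / h) * h = K₀ * h + |C| := by field_simp
      rw [e]
      have := le_abs_self C
      have : 0 ≤ K₀ * h := by positivity
      linarith
    nlinarith

theorem tendsto_harm_succ_div : Tendsto (fun n : ℕ => harm (n + 1) / ((n : ℝ) + 1)) atTop (𝓝 0) := by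
  have := tendsto_harm_div.comp (tendsto_add_atTop_nat 1)
  refine this.congr fun n => by simp [Function.comp]

theorem tendsto_const_div_succ (c : ℝ) :
    Tendsto (fun n : ℕ => c / ((n : ℝ) + 1)) atTop (𝓝 0) := by
  simpa [div_eq_mul_inv] using (tendsto_one_div_add_atTop_nhds_zero_nat (𝕜 := ℝ)).const_mul c

/-- The upper half of the transfer theorem: `(n + 1) * H_{n+1}` solves the recurrence with a toll
`∼ harmonicGap t * n`, so a multiple of it plus a linear term is a supersolution. -/
theorem exists_le_of_toll_le {t : ℕ} {u : ℕ → ℝ} {κ ε : ℝ} (hε : 0 < ε)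
    (hu : ∀ᶠ n in atTop, u (n + 1) - 2 * medianMean t u n ≤ (κ + ε / 2) * (n + 1)) :
    ∃ K : ℝ, ∀ n, u n ≤ (κ + ε) / harmonicGap t * ((n + 1) * harm (n + 1)) + K * (n + 1) := by
  have hH := harmonicGap_pos t
  set c := (κ + ε) / harmonicGap t with hc
  have hlim : Tendsto (fun n : ℕ => -c * (harm (n + 1) / ((n : ℝ) + 1)) + (-c) / ((n : ℝ) + 1))
      atTop (𝓝 0) := by
    simpa using (tendsto_harm_succ_div.const_mul (-c)).add (tendsto_const_div_succ (-c))
  obtain ⟨n₀, hn₀⟩ := eventually_atTop.1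
    ((hu.and (hlim.eventually_lt_const (half_pos hε))).and (eventually_ge_atTop (2 * t + 1)))
  obtain ⟨K, hK0, hK⟩ := exists_nonneg_bound (fun n => u n - c * ((n + 1) * harm (n + 1))) n₀
  refine ⟨K, le_of_supersolution (t := t) (n₀ := n₀) zero_le_two ?_ ?_⟩
  · intro n hn
    have h1 := hK n hn
    have : (0 : ℝ) ≤ n := n.cast_nonneg
    nlinarith
  · intro n hn
    obtain ⟨⟨h1, h2⟩, h3⟩ := hn₀ n hn
    refine h1.trans ?_
    rw [medianMean_add, medianMean_const_mul, medianMean_const_mul]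
    have e1 := two_mul_medianMean_succ_mul_harm h3
    have e2 := two_mul_medianMean_succ h3
    have hpos : (0 : ℝ) < n + 1 := by positivity
    have h4 : -c * (harm (n + 1) + 1) ≤ ε / 2 * (n + 1) := by
      have : -c * (harm (n + 1) / ((n : ℝ) + 1)) + (-c) / ((n : ℝ) + 1) =
          -c * (harm (n + 1) + 1) / (n + 1) := by ring
      rw [this, div_lt_iff₀ hpos] at h2
      exact h2.le
    have e3 : c * harmonicGap t = κ + ε := by rw [hc]; field_simp
    have e4 := harm_succ (n + 1)
    have e5 : ((n + 1 : ℕ) + 1 : ℝ) * harm (n + 1 + 1) = (n + 2) * harm (n + 1) + 1 := by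
      rw [e4]; push_cast; field_simp; ring
    rw [e5]
    push_cast
    have e6 : 2 * (c * medianMean t (fun i => ((i : ℝ) + 1) * harm (i + 1)) n +
        K * medianMean t (fun i => (i : ℝ) + 1) n) =
        c * ((n + 1) * harm (n + 1)) - (κ + ε) * (n + 1) + K * (n + 1) := by
      rw [← e3]
      linear_combination c * e1 + K * e2
    rw [e6]
    linarith

/-- Transfer theorem: a toll `∼ κ * n` leads to a total `∼ κ / harmonicGap t * n * log n`. -/
theorem tendsto_of_toll {t : ℕ} {u : ℕ → ℝ} {κ : ℝ}
    (hu : Tendsto (fun n : ℕ => (u (n + 1) - 2 * medianMean t u n) / ((n : ℝ) + 1))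
      atTop (𝓝 κ)) :
    Tendsto (fun n : ℕ => u n / (((n : ℝ) + 1) * harm (n + 1))) atTop
      (𝓝 (κ / harmonicGap t)) := by
  have hH := harmonicGap_pos t
  have hinv : ∀ K : ℝ, Tendsto (fun n : ℕ => K / harm (n + 1)) atTop (𝓝 0) := fun K =>
    tendsto_const_nhds.div_atTop (tendsto_harm_atTop.comp (tendsto_add_atTop_nat 1))
  have key : ∀ (v : ℕ → ℝ) (μ : ℝ),
      Tendsto (fun n : ℕ => (v (n + 1) - 2 * medianMean t v n) / ((n : ℝ) + 1)) atTop (𝓝 μ) →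
      ∀ δ > 0, ∀ᶠ n : ℕ in atTop,
        v n / (((n : ℝ) + 1) * harm (n + 1)) < μ / harmonicGap t + δ := by
    intro v μ hv δ hδ
    set ε := δ * harmonicGap t / 2 with hε
    have hε0 : 0 < ε := by positivity
    obtain ⟨K, hK⟩ := exists_le_of_toll_le (t := t) (u := v) (κ := μ) hε0 (by
      filter_upwards [hv.eventually_lt_const (show μ < μ + ε / 2 by linarith)] with n hn
      rw [div_lt_iff₀ (by positivity)] at hn
      exact hn.le)
    filter_upwards [(hinv K).eventually_lt_const (half_pos hδ)] with n hn
    have h1 := one_le_harm_succ n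
    have hpos : (0 : ℝ) < ((n : ℝ) + 1) * harm (n + 1) := by positivity
    have e : (μ + ε) / harmonicGap t = μ / harmonicGap t + δ / 2 := by
      rw [hε]; field_simp
    have h2 := hK n
    rw [div_lt_iff₀ hpos]
    rw [div_lt_iff₀ (by linarith)] at hn
    rw [e] at h2
    have h3 : K * ((n : ℝ) + 1) < δ / 2 * harm (n + 1) * (n + 1) :=
      mul_lt_mul_of_pos_right hn (by positivity)
    nlinarith
  rw [tendsto_order]
  constructor
  · intro a ha
    have h1 : Tendsto (fun n : ℕ => (-u (n + 1) -
        2 * medianMean t (fun n => -u n) n) / ((n : ℝ) + 1)) atTop (𝓝 (-κ)) := by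
      refine hu.neg.congr fun n => ?_
      have := medianMean_const_mul (t := t) (N := n) (f := u) (-1)
      simp only [neg_one_mul] at this
      rw [this]
      ring
    filter_upwards [key (fun n => -u n) (-κ) h1 (κ / harmonicGap t - a) (by linarith)] with n hn
    have e1 : -κ / harmonicGap t = -(κ / harmonicGap t) := by ring
    have e2 : -u n / (((n : ℝ) + 1) * harm (n + 1)) = -(u n / (((n : ℝ) + 1) * harm (n + 1))) := by
      ring
    rw [e1, e2] at hn
    linarith
  · intro a ha
    filter_upwards [key u κ hu (a - κ / harmonicGap t) (by linarith)] with n hn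
    linarith

/-! ### The recurrence with unit toll -/

/-- Stochastic monotonicity of the median: deleting a uniformly random element outside of the
random `(2t+1)`-subset of `{0, …, N}` leaves a random `(2t+1)`-subset of `N` elements. -/
theorem split_eq_add {t N i : ℕ} (hi : i < N) (hN : 2 * t + 1 ≤ N) :
    split t N i * (N - 2 * t) =
      ((i : ℝ) + 1 - t) * split t (N + 1) (i + 1) + ((N : ℝ) - i - t) * split t (N + 1) i := by
  have step : ∀ n s : ℕ, ((n + 1 : ℕ) : ℝ) * n.choose s = (n + 1).choose s * ((n : ℝ) + 1 - s) := by
    intro n s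
    have h : (n + 1) * n.choose s + (n + 1).choose s * s = (n + 1).choose s * (n + 1) := by
      have h1 := Nat.add_one_mul_choose_eq n s
      have h2 := Nat.choose_succ_right_eq (n + 1) s
      by_cases hs : s ≤ n + 1
      · have : (n + 1 - s) + s = n + 1 := by omega
        calc _ = (n + 1).choose s * (n + 1 - s) + (n + 1).choose s * s := by rw [h1, h2]
          _ = _ := by rw [← mul_add, this]
      · rw [Nat.choose_eq_zero_of_lt (by omega : n < s),
          Nat.choose_eq_zero_of_lt (by omega : n + 1 < s)]
        simp
    have h' : ((n + 1 : ℕ) : ℝ) * n.choose s + (n + 1).choose s * s =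
        (n + 1).choose s * ((n + 1 : ℕ) : ℝ) := by exact_mod_cast h
    push_cast at h' ⊢
    linear_combination h'
  have a1 := step i t
  have a2 := step (N - 1 - i) t
  have a3 := step N (2 * t + 1)
  have e1 : N - 1 - i + 1 = N - i := by omega
  have e2 : N + 1 - 1 - (i + 1) = N - 1 - i := by omega
  have e3 : N + 1 - 1 - i = N - i := by omega
  have e4 : ((N - 1 - i : ℕ) : ℝ) = N - 1 - i := by
    rw [Nat.cast_sub (by omega), Nat.cast_sub (by omega)]; simp
  rw [e1] at a2
  have e5 : ((N - i : ℕ) : ℝ) = N - i := by rw [Nat.cast_sub hi.le]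
  rw [e5, e4] at a2
  push_cast at a1 a3
  have h3 := choose_pos_real hN
  have h4 := choose_pos_real (show 2 * t + 1 ≤ N + 1 by omega)
  unfold split
  rw [e2, e3, ← sub_eq_zero]
  field_simp
  set x : ℝ := ((N - 1 - i).choose t : ℝ)
  set y : ℝ := (i.choose t : ℝ)
  linear_combination x * y * (-a3) + (N.choose (2 * t + 1) : ℝ) * x * a1 +
    (N.choose (2 * t + 1) : ℝ) * y * a2

theorem medianMean_le_succ {t N : ℕ} {f : ℕ → ℝ} (hN : 2 * t + 1 ≤ N)
    (hf : ∀ i < N, f i ≤ f (i + 1)) : medianMean t f N ≤ medianMean t f (N + 1) := by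
  have hpos : (0 : ℝ) < N - 2 * t := by
    have : ((2 * t + 1 : ℕ) : ℝ) ≤ N := by exact_mod_cast hN
    push_cast at this
    linarith
  have hle : ∀ i ∈ Finset.range N, split t N i * f i * (N - 2 * t) ≤
      ((i : ℝ) + 1 - t) * split t (N + 1) (i + 1) * f (i + 1) +
        ((N : ℝ) - i - t) * split t (N + 1) i * f i := by
    intro i hi
    have hi := Finset.mem_range.1 hi
    have h1 := split_eq_add hi hN
    have h2 : 0 ≤ ((i : ℝ) + 1 - t) * split t (N + 1) (i + 1) := by
      by_cases hti : t ≤ i + 1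
      · have : (t : ℝ) ≤ i + 1 := by exact_mod_cast hti
        exact mul_nonneg (by linarith) (split_nonneg _ _ _)
      · simp [split, Nat.choose_eq_zero_of_lt (show i + 1 < t by omega)]
    have h3 := mul_le_mul_of_nonneg_left (hf i hi) h2
    have e : split t N i * f i * (N - 2 * t) = split t N i * (N - 2 * t) * f i := by ring
    rw [e, h1]
    linarith
  have h1 := Finset.sum_le_sum hle
  rw [Finset.sum_add_distrib, ← Finset.sum_mul] at h1
  have h2 : ∑ i ∈ Finset.range N, ((i : ℝ) + 1 - t) * split t (N + 1) (i + 1) * f (i + 1) =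
      ∑ i ∈ Finset.range (N + 1), ((i : ℝ) - t) * split t (N + 1) i * f i := by
    rw [Finset.sum_range_succ']
    have : ((0 : ℕ) - t : ℝ) * split t (N + 1) 0 = 0 := by
      cases t <;> simp [split]
    rw [this, zero_mul, add_zero]
    exact Finset.sum_congr rfl fun i _ => by push_cast; ring
  have h3 : ∑ i ∈ Finset.range N, ((N : ℝ) - i - t) * split t (N + 1) i * f i =
      ∑ i ∈ Finset.range (N + 1), ((N : ℝ) - i - t) * split t (N + 1) i * f i := by
    rw [Finset.sum_range_succ]
    have : ((N : ℝ) - N - t) * split t (N + 1) N = 0 := by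
      cases t <;> simp [split]
    rw [this, zero_mul, add_zero]
  rw [h2, h3, ← Finset.sum_add_distrib] at h1
  have h4 : ∑ i ∈ Finset.range (N + 1), (((i : ℝ) - t) * split t (N + 1) i * f i +
      ((N : ℝ) - i - t) * split t (N + 1) i * f i) =
      medianMean t f (N + 1) * (N - 2 * t) := by
    rw [medianMean, Finset.sum_mul]
    exact Finset.sum_congr rfl fun i _ => by ring
  rw [h4] at h1
  exact le_of_mul_le_mul_right h1 hpos

/-- The entries of the Leibniz harmonic triangle. -/
noncomputable def leibniz (N r : ℕ) : ℝ := 1 / ((N + 1) * N.choose r)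

theorem leibniz_nonneg (N r : ℕ) : 0 ≤ leibniz N r := by unfold leibniz; positivity

theorem leibniz_eq_add {N r : ℕ} (h : r ≤ N) :
    leibniz N r = leibniz (N + 1) r + leibniz (N + 1) (r + 1) := by
  have h1 : (0 : ℝ) < N.choose r := by exact_mod_cast Nat.choose_pos h
  have h2 : (0 : ℝ) < (N + 1).choose r := by exact_mod_cast Nat.choose_pos (by omega)
  have h3 : (0 : ℝ) < (N + 1).choose (r + 1) := by exact_mod_cast Nat.choose_pos (by omega)
  have a1 : ((N + 1 : ℕ) : ℝ) * N.choose r = (N + 1).choose (r + 1) * ((r + 1 : ℕ) : ℝ) := by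
    exact_mod_cast Nat.add_one_mul_choose_eq N r
  have a2 : ((N + 1).choose (r + 1) : ℝ) * ((r + 1 : ℕ) : ℝ) =
      (N + 1).choose r * ((N + 1 : ℝ) - r) := by
    have := Nat.choose_succ_right_eq (N + 1) r
    have e : ((N + 1 - r : ℕ) : ℝ) = (N + 1 : ℝ) - r := by
      rw [Nat.cast_sub (by omega)]; push_cast; ring
    rw [← e]
    exact_mod_cast this
  have hr : (r : ℝ) ≤ N := by exact_mod_cast h
  have hN : (0 : ℝ) < (N : ℝ) + 1 - r := by linarith
  push_cast at a1 a2
  unfold leibniz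
  push_cast
  set b := ((N + 1).choose r : ℝ)
  have hc : ((N + 1).choose (r + 1) : ℝ) = b * (N + 1 - r) / (r + 1) := by
    rw [eq_div_iff (by positivity)]; exact a2
  have hn : (N.choose r : ℝ) = b * (N + 1 - r) / (N + 1) := by
    rw [eq_div_iff (by positivity), mul_comm, a1, a2]
  rw [hc, hn]
  rw [← sub_eq_zero]
  field_simp
  ring

/-- The law of the `(t+2)`-nd smallest element of a random `(2t+2)`-subset of `{0, …, n}`, shifted
by one. It is the transition probability from `n` to `i` of the Markov chain that moves from a random
jumplist with `n + 2` nodes to one of its sublists, chosen with probability proportional to its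
number `i + 1` of nodes. -/
noncomputable def stepProb (t n i : ℕ) : ℝ :=
  ((i + 1).choose (t + 1) * (n - 1 - i).choose t : ℝ) / (n + 1).choose (2 * t + 2)

theorem stepProb_nonneg (t n i : ℕ) : 0 ≤ stepProb t n i := by unfold stepProb; positivity

theorem sum_stepProb {t n : ℕ} (hn : 2 * t + 1 ≤ n) :
    ∑ i ∈ Finset.range n, stepProb t n i = 1 := by
  have h : (0 : ℝ) < (n + 1).choose (2 * t + 2) := by exact_mod_cast Nat.choose_pos (by omega)
  unfold stepProb
  rw [← Finset.sum_div, sum_choose_succ_mul_choose, div_self h.ne']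

theorem two_mul_medianMean_eq {t n : ℕ} (hn : 2 * t + 1 ≤ n) (f : ℕ → ℝ) :
    2 * medianMean t f n = (n + 1) * ∑ i ∈ Finset.range n, stepProb t n i * (f i / (i + 1)) := by
  rw [medianMean, Finset.mul_sum, Finset.mul_sum]
  refine Finset.sum_congr rfl fun i _ => ?_
  have h := two_mul_split_mul i hn
  have h0 : (0 : ℝ) < i + 1 := by positivity
  have e : 2 * (split t n i * f i) = 2 * (split t n i * (i + 1)) * (f i / (i + 1)) := by
    field_simp
  rw [e, h, stepProb]
  ring

/-- The flow from states above `m` to the state `i ≤ m` under the measure `1 / (n + 2)`, which is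
invariant for the chain `stepProb t`. -/
noncomputable def flow (t m i : ℕ) : ℝ :=
  (i + 1).choose (t + 1) *
    ∑ j ∈ Finset.range (t + 1), (m - i).choose j * leibniz (m + 1) (t + 1 + j)

theorem flow_nonneg (t m i : ℕ) : 0 ≤ flow t m i :=
  mul_nonneg (Nat.cast_nonneg _) (Finset.sum_nonneg fun _ _ =>
    mul_nonneg (Nat.cast_nonneg _) (leibniz_nonneg _ _))

theorem flow_self {t m : ℕ} (h : t ≤ m) : flow t m m = 1 / (m + 2) := by
  have h1 : (0 : ℝ) < (m + 1).choose (t + 1) := by exact_mod_cast Nat.choose_pos (by omega)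
  rw [flow, Finset.sum_range_succ', Finset.sum_eq_zero fun j _ => by simp]
  simp only [Nat.sub_self, Nat.choose_self, leibniz]
  push_cast
  field_simp
  ring

theorem flow_self_of_lt {t m : ℕ} (h : m < t) : flow t m m = 0 := by
  simp [flow, Nat.choose_eq_zero_of_lt (show m + 1 < t + 1 by omega)]

/-- Pascal's rule and the Leibniz triangle make the flow telescope. -/
theorem flow_eq_add {t m i : ℕ} (hi : i ≤ m) :
    flow t m i = flow t (m + 1) i +
      (i + 1).choose (t + 1) * (m - i).choose t * leibniz (m + 2) (2 * t + 2) := by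
  by_cases hti : i < t
  · simp [flow, Nat.choose_eq_zero_of_lt (show i + 1 < t + 1 by omega)]
  push Not at hti
  have h1 : ∀ j ∈ Finset.range (t + 1),
      ((m - i).choose j : ℝ) * leibniz (m + 1) (t + 1 + j) =
      (m - i).choose j * leibniz (m + 2) (t + 1 + j) +
        (m - i).choose j * leibniz (m + 2) (t + 1 + (j + 1)) := by
    intro j _
    by_cases hj : j ≤ m - i
    · rw [leibniz_eq_add (by omega)]
      rw [show t + 1 + j + 1 = t + 1 + (j + 1) by ring]
      ring
    · simp [Nat.choose_eq_zero_of_lt (show m - i < j by omega)]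
  have h2 : ∑ j ∈ Finset.range (t + 1), ((m + 1 - i).choose j : ℝ) * leibniz (m + 2) (t + 1 + j) =
      ∑ j ∈ Finset.range (t + 1), ((m - i).choose j : ℝ) * leibniz (m + 2) (t + 1 + j) +
      ∑ j ∈ Finset.range t, ((m - i).choose j : ℝ) * leibniz (m + 2) (t + 1 + (j + 1)) := by
    have h3 : ∑ j ∈ Finset.range t,
        ((m + 1 - i).choose (j + 1) : ℝ) * leibniz (m + 2) (t + 1 + (j + 1)) =
        ∑ j ∈ Finset.range t, ((m - i).choose (j + 1) : ℝ) * leibniz (m + 2) (t + 1 + (j + 1)) +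
        ∑ j ∈ Finset.range t, ((m - i).choose j : ℝ) * leibniz (m + 2) (t + 1 + (j + 1)) := by
      rw [← Finset.sum_add_distrib]
      refine Finset.sum_congr rfl fun j _ => ?_
      rw [show m + 1 - i = (m - i) + 1 by omega, Nat.choose_succ_succ]
      push_cast
      ring
    rw [Finset.sum_range_succ', Finset.sum_range_succ' _ t, h3]
    simp only [Nat.choose_zero_right]
    ring
  unfold flow
  rw [Finset.sum_congr rfl h1, Finset.sum_add_distrib, h2,
    Finset.sum_range_succ (fun j => ((m - i).choose j : ℝ) * leibniz (m + 2) (t + 1 + (j + 1)))]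
  rw [show t + 1 + (t + 1) = 2 * t + 2 by ring]
  ring

theorem flow_eq_add_stepProb {t m i : ℕ} (hi : i ≤ m) :
    flow t m i = flow t (m + 1) i + stepProb t (m + 1) i / (m + 3) := by
  rw [flow_eq_add hi, stepProb, leibniz, show m + 1 - 1 - i = m - i by omega,
    show m + 1 + 1 = m + 2 by ring]
  push_cast
  rw [show (m : ℝ) + 2 + 1 = m + 3 by ring]
  rw [mul_one_div, div_div, mul_comm ((m : ℝ) + 3)]

theorem sum_flow_mul_succ (t m : ℕ) (b : ℕ → ℝ) :
    ∑ i ∈ Finset.range (m + 2), flow t (m + 1) i * b i =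
      ∑ i ∈ Finset.range (m + 1), flow t m i * b i + flow t (m + 1) (m + 1) * b (m + 1) -
        (∑ i ∈ Finset.range (m + 1), stepProb t (m + 1) i * b i) / (m + 3) := by
  rw [Finset.sum_range_succ, Finset.sum_div]
  have : ∀ i ∈ Finset.range (m + 1), flow t (m + 1) i * b i =
      flow t m i * b i - stepProb t (m + 1) i * b i / (m + 3) := by
    intro i hi
    have := Finset.mem_range.1 hi
    rw [flow_eq_add_stepProb (show i ≤ m by omega)]
    ring
  rw [Finset.sum_congr rfl this, Finset.sum_sub_distrib]
  ring

/-- The total flow across a level does not depend on the level, as soon as the steps from this level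
and above have total probability one. -/
theorem sum_flow {t m : ℕ} (hm : 2 * t ≤ m) :
    ∑ i ∈ Finset.range (m + 1), flow t m i = harmonicGap t := by
  have hstep := fun m => sum_flow_mul_succ t m (fun _ => 1)
  simp only [mul_one] at hstep
  -- From a state `m ≤ 2t` no step is possible: all `stepProb t m i` vanish, and the flow to `m` itself
  -- is `1 / (m + 2)` if `t ≤ m` and zero otherwise.
  have hlow : ∀ m ≤ 2 * t, ∑ i ∈ Finset.range (m + 1), flow t m i =
      harm (max (m + 2) (t + 1)) - harm (t + 1) := by
    intro m
    induction m with
    | zero =>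
      intro _
      rw [Finset.sum_range_one]
      cases t with
      | zero =>
        rw [flow_self le_rfl]
        have h1 := harm_succ 0
        have h2 := harm_succ 1
        simp only [Nat.cast_zero, Nat.cast_one] at h1 h2
        simp only [zero_add, Nat.cast_zero] at h1 h2 ⊢
        rw [show max 2 1 = 1 + 1 by rfl, h2]
        norm_num
      | succ t =>
        rw [flow_self_of_lt (by omega), max_eq_right (by omega), sub_self]
    | succ m ih =>
      intro hm
      have hz : ∑ i ∈ Finset.range (m + 1), stepProb t (m + 1) i = 0 := by
        unfold stepProb
        rw [← Finset.sum_div, sum_choose_succ_mul_choose]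
        simp [Nat.choose_eq_zero_of_lt (show m + 1 + 1 < 2 * t + 2 by omega)]
      rw [hstep, ih (by omega), hz, zero_div, sub_zero]
      by_cases hmt : t ≤ m + 1
      · rw [flow_self hmt, max_eq_left (by omega : t + 1 ≤ m + 1 + 2),
          max_eq_left (by omega : t + 1 ≤ m + 2), harm_succ (m + 2)]
        push_cast
        ring
      · rw [flow_self_of_lt (by omega), max_eq_right (by omega), max_eq_right (by omega), add_zero]
  induction m, hm using Nat.le_induction with
  | base =>
    rw [hlow _ le_rfl, harmonicGap_eq, max_eq_left (by omega)]
  | succ m hm ih =>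
    rw [hstep, ih, flow_self (by omega), sum_stepProb (by omega)]
    push_cast
    ring

/-- Up to a constant factor, the flow across level `n / 2` is dominated by one step from `n`. -/
theorem exists_flow_le_stepProb (t : ℕ) : ∃ C : ℝ, 0 < C ∧ ∀ n, 8 * t + 10 ≤ n →
    ∀ i ≤ n / 2, flow t (n / 2) i ≤ C * stepProb t n i := by
  set A : ℝ := (t + 1) * ((2 * t + 1).factorial * 2 ^ (2 * t + 1)) with hA
  set B : ℝ := 2 ^ t * t.factorial * 4 ^ (2 * t + 2) with hB
  have hA0 : 0 < A := by positivity
  have hB0 : 0 < B := by positivity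
  refine ⟨A * B, by positivity, fun n hn i hi => ?_⟩
  set m := n / 2 with hm
  have hm4 : 4 * t + 5 ≤ m := by omega
  have hm0 : (0 : ℝ) < m := by exact_mod_cast (show 0 < m by omega)
  have hm1 : (1 : ℝ) ≤ m := by exact_mod_cast (show 1 ≤ m by omega)
  have hleft : ∑ j ∈ Finset.range (t + 1), ((m - i).choose j : ℝ) * leibniz (m + 1) (t + 1 + j) ≤
      A / (m : ℝ) ^ (t + 2) := by
    have hterm : ∀ j ∈ Finset.range (t + 1),
        ((m - i).choose j : ℝ) * leibniz (m + 1) (t + 1 + j) ≤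
        ((2 * t + 1).factorial * 2 ^ (2 * t + 1)) / (m : ℝ) ^ (t + 2) := by
      intro j hj
      have hj := Finset.mem_range.1 hj
      have h1 : ((m - i).choose j : ℝ) ≤ (m : ℝ) ^ j := by
        have h : (m - i).choose j ≤ m ^ j :=
          (Nat.choose_le_pow _ _).trans (Nat.pow_le_pow_left (by omega) _)
        exact_mod_cast h
      have h2 : ((m : ℝ) / 2) ^ (t + 1 + j) / (2 * t + 1).factorial ≤
          (m + 1).choose (t + 1 + j) := by
        refine le_trans ?_ (Nat.pow_le_choose (α := ℝ) (t + 1 + j) (m + 1))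
        have h3 : (m : ℝ) / 2 ≤ ((m + 1 + 1 - (t + 1 + j) : ℕ) : ℝ) := by
          rw [div_le_iff₀ two_pos]
          exact_mod_cast (show m ≤ (m + 1 + 1 - (t + 1 + j)) * 2 by omega)
        have h4 : ((t + 1 + j).factorial : ℝ) ≤ (2 * t + 1).factorial := by
          exact_mod_cast Nat.factorial_le (by omega)
        have h5 : (0 : ℝ) < (t + 1 + j).factorial := by positivity
        gcongr
      have h3 : (0 : ℝ) < ((m : ℝ) / 2) ^ (t + 1 + j) / (2 * t + 1).factorial := by positivity
      have h4 : leibniz (m + 1) (t + 1 + j) ≤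
          1 / (m * (((m : ℝ) / 2) ^ (t + 1 + j) / (2 * t + 1).factorial)) := by
        unfold leibniz
        push_cast
        gcongr
        linarith
      have h5 : (2 : ℝ) ^ (t + 1 + j) ≤ 2 ^ (2 * t + 1) :=
        pow_le_pow_right₀ one_le_two (by omega)
      calc ((m - i).choose j : ℝ) * leibniz (m + 1) (t + 1 + j)
          ≤ (m : ℝ) ^ j * (1 / (m * (((m : ℝ) / 2) ^ (t + 1 + j) / (2 * t + 1).factorial))) :=
            mul_le_mul h1 h4 (leibniz_nonneg _ _) (by positivity)
        _ = ((2 * t + 1).factorial * 2 ^ (t + 1 + j)) / (m : ℝ) ^ (t + 2) := by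
            rw [div_pow]
            field_simp
            ring
        _ ≤ _ := by gcongr
    refine (Finset.sum_le_sum hterm).trans (le_of_eq ?_)
    rw [Finset.sum_const, Finset.card_range, nsmul_eq_mul, hA]
    push_cast
    ring
  have hright : 1 / (m : ℝ) ^ (t + 2) ≤
      B * (((n - 1 - i).choose t : ℝ) / (n + 1).choose (2 * t + 2)) := by
    have h1 : ((m : ℝ) / 2) ^ t / t.factorial ≤ (n - 1 - i).choose t := by
      refine le_trans ?_ (Nat.pow_le_choose (α := ℝ) t (n - 1 - i))
      have h3 : (m : ℝ) / 2 ≤ ((n - 1 - i + 1 - t : ℕ) : ℝ) := by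
        rw [div_le_iff₀ two_pos]
        exact_mod_cast (show m ≤ (n - 1 - i + 1 - t) * 2 by omega)
      gcongr
    have h2 : ((n + 1).choose (2 * t + 2) : ℝ) ≤ (4 * (m : ℝ)) ^ (2 * t + 2) := by
      have h : (n + 1).choose (2 * t + 2) ≤ (4 * m) ^ (2 * t + 2) :=
        (Nat.choose_le_pow _ _).trans (Nat.pow_le_pow_left (by omega) _)
      exact_mod_cast h
    have h3 : (0 : ℝ) < (n + 1).choose (2 * t + 2) := by
      exact_mod_cast Nat.choose_pos (by omega)
    calc 1 / (m : ℝ) ^ (t + 2) =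
          B * ((((m : ℝ) / 2) ^ t / t.factorial) / (4 * (m : ℝ)) ^ (2 * t + 2)) := by
          rw [hB, div_pow, mul_pow]
          field_simp
          ring
      _ ≤ _ := by gcongr
  calc flow t m i ≤ (i + 1).choose (t + 1) * (A / (m : ℝ) ^ (t + 2)) :=
        mul_le_mul_of_nonneg_left hleft (Nat.cast_nonneg _)
    _ = (i + 1).choose (t + 1) * (A * (1 / (m : ℝ) ^ (t + 2))) := by ring
    _ ≤ (i + 1).choose (t + 1) *
        (A * (B * (((n - 1 - i).choose t : ℝ) / (n + 1).choose (2 * t + 2)))) := by gcongr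
    _ = A * B * stepProb t n i := by rw [stepProb]; ring

theorem sum_stepProb_initial_le {t n n₀ : ℕ} (hn : 2 * t + 1 ≤ n) :
    ∑ i ∈ Finset.range n, stepProb t n i * (if i < n₀ then 1 else 0) ≤ 2 * n₀ / (n + 1) := by
  have h := two_mul_medianMean_eq (t := t) hn (fun i => if i < n₀ then (i : ℝ) + 1 else 0)
  have h1 : medianMean t (fun i => if i < n₀ then (i : ℝ) + 1 else 0) n ≤ n₀ := by
    rw [← medianMean_const (t := t) hn (n₀ : ℝ)]
    refine medianMean_mono fun i _ => ?_
    split_ifs with hi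
    · exact_mod_cast hi
    · positivity
  have e : ∀ i : ℕ, (if i < n₀ then (i : ℝ) + 1 else 0) / (i + 1) = if i < n₀ then 1 else 0 := by
    intro i
    have : (0 : ℝ) < i + 1 := by positivity
    split_ifs
    · exact div_self this.ne'
    · exact zero_div _
  simp only [e] at h
  rw [le_div_iff₀ (by positivity), mul_comm, ← h]
  linarith

/-- The averages `flow t m` of a sequence that is subharmonic for `stepProb t` up to the toll
`1 / (n + 1)`. Passing level `n` adds at most `1 / ((n + 1) * (n + 2))`, and these bounds telescope. -/
theorem sum_flow_mul_le {t w m : ℕ} (hw : 2 * t + 2 ≤ w) {b : ℕ → ℝ} (h0 : ∀ n < w, b n = 0)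
    (hb : ∀ n, w ≤ n → b n ≤ (∑ i ∈ Finset.range n, stepProb t n i * b i) + 1 / (n + 1))
    (hm : w ≤ m + 1) :
    ∑ i ∈ Finset.range (m + 1), flow t m i * b i ≤ 1 / (w + 1) - 1 / (m + 2) := by
  obtain ⟨w, rfl⟩ : ∃ v, w = v + 1 := ⟨w - 1, by omega⟩
  have hm' : w ≤ m := by omega
  clear hm
  induction m, hm' using Nat.le_induction with
  | base =>
    rw [Finset.sum_eq_zero fun i hi => by rw [h0 i (Finset.mem_range.1 hi), mul_zero]]
    push_cast
    rw [show (w : ℝ) + 1 + 1 = w + 2 by ring, sub_self]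
  | succ m hm ih =>
    rw [sum_flow_mul_succ, flow_self (by omega)]
    have h1 := hb (m + 1) (by omega)
    have h2 : (0 : ℝ) < (m : ℝ) + 3 := by positivity
    have h3 := div_le_div_of_nonneg_right h1 h2.le
    rw [add_div] at h3
    push_cast at ih h3 ⊢
    rw [show (m : ℝ) + 1 + 2 = m + 3 by ring, one_div_mul_eq_div]
    have e : 1 / ((m : ℝ) + 1 + 1) / (m + 3) = 1 / (m + 2) - 1 / (m + 3) := by
      rw [show (m : ℝ) + 1 + 1 = m + 2 by ring]
      field_simp
      ring
    rw [e] at h3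
    linarith

/-- If `b n` is close to the limit superior `β`, then subharmonicity makes the mean deficit `β - b i`
after one step from `n` small. The flow across level `n / 2` is dominated by this step, so the
average of `b` under the flow is close to `β * harmonicGap t`, while it is at most `1 / (w + 1)`. -/
theorem limsup_le_of_subharmonic {t w : ℕ} (hw : 2 * t + 2 ≤ w) {b : ℕ → ℝ}
    (h0 : ∀ n < w, b n = 0) (hnn : ∀ n, 0 ≤ b n) (h1 : ∀ n, b n ≤ 1)
    (hb : ∀ n, w ≤ n → b n ≤ (∑ i ∈ Finset.range n, stepProb t n i * b i) + 1 / (n + 1)) :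
    limsup b atTop ≤ 1 / ((w + 1) * harmonicGap t) := by
  have hH := harmonicGap_pos t
  have hbdd : IsBoundedUnder (· ≤ ·) atTop b := isBoundedUnder_of ⟨1, h1⟩
  have hcobdd : IsCoboundedUnder (· ≤ ·) atTop b :=
    (isBoundedUnder_of ⟨0, hnn⟩ : IsBoundedUnder (· ≥ ·) atTop b).isCoboundedUnder_le
  by_contra! hcon
  set β := limsup b atTop with hβ
  set η := β * harmonicGap t - 1 / (w + 1) with hη
  have hη0 : 0 < η := by
    rw [div_lt_iff₀ (by positivity)] at hcon
    have : (1 : ℝ) / (w + 1) < β * harmonicGap t := by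
      rw [div_lt_iff₀ (by positivity)]
      linarith
    linarith
  obtain ⟨C, hC, hflow⟩ := exists_flow_le_stepProb t
  set δ := η / (8 * C) with hδ
  have hδ0 : 0 < δ := by positivity
  have hβ0 : 0 ≤ β := le_trans (by positivity) hcon.le
  obtain ⟨n₀, hn₀⟩ := eventually_atTop.1
    (eventually_lt_of_limsup_lt (show limsup b atTop < β + δ by linarith) hbdd)
  have hfreq : ∃ᶠ n in atTop, β - δ < b n :=
    frequently_lt_of_lt_limsup hcobdd (by linarith)
  have hsmall : ∀ᶠ n : ℕ in atTop, (2 * n₀ + 1 : ℝ) / ((n : ℝ) + 1) < η / (4 * C) :=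
    (tendsto_const_div_succ _).eventually_lt_const (by positivity)
  obtain ⟨n, hbn, hn1, hn2⟩ := (hfreq.and_eventually
    (hsmall.and (eventually_ge_atTop (8 * t + 10 + 2 * w + 2)))).exists
  set m := n / 2 with hm
  have hmn : m + 1 ≤ n := by omega
  have h2tn : 2 * t + 1 ≤ n := by omega
  -- The deficit of `b`; the indicator keeps it nonnegative on an initial segment, which has small
  -- probability.
  set e : ℕ → ℝ := fun i => (β + δ) + (if i < n₀ then 1 else 0) - b i with he
  have he0 : ∀ i, 0 ≤ e i := by
    intro i
    simp only [he]
    split_ifs with hi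
    · linarith [h1 i]
    · linarith [hn₀ i (by omega)]
  have hA : ∑ i ∈ Finset.range (m + 1), flow t m i * e i ≤
      C * ∑ i ∈ Finset.range n, stepProb t n i * e i := by
    rw [Finset.mul_sum]
    calc _ ≤ ∑ i ∈ Finset.range (m + 1), C * (stepProb t n i * e i) := by
          refine Finset.sum_le_sum fun i hi => ?_
          have hi := Finset.mem_range.1 hi
          rw [← mul_assoc]
          exact mul_le_mul_of_nonneg_right (hflow n (by omega) i (by omega)) (he0 i)
      _ ≤ _ := Finset.sum_le_sum_of_subset_of_nonneg
          (fun i hi => Finset.mem_range.2 ((Finset.mem_range.1 hi).trans_le hmn))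
          fun i _ _ => mul_nonneg hC.le (mul_nonneg (stepProb_nonneg _ _ _) (he0 i))
  have hB : η ≤ ∑ i ∈ Finset.range (m + 1), flow t m i * e i := by
    have hΦ := sum_flow_mul_le (m := m) hw h0 hb (by omega)
    have h3 : ∑ i ∈ Finset.range (m + 1), flow t m i * e i =
        (∑ i ∈ Finset.range (m + 1), flow t m i) * (β + δ) +
        ∑ i ∈ Finset.range (m + 1), flow t m i * (if i < n₀ then 1 else 0) -
        ∑ i ∈ Finset.range (m + 1), flow t m i * b i := by
      rw [Finset.sum_mul, ← Finset.sum_add_distrib, ← Finset.sum_sub_distrib]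
      exact Finset.sum_congr rfl fun i _ => by simp only [he]; ring
    have h4 : 0 ≤ ∑ i ∈ Finset.range (m + 1), flow t m i * (if i < n₀ then (1 : ℝ) else 0) :=
      Finset.sum_nonneg fun i _ => mul_nonneg (flow_nonneg _ _ _) (by split_ifs <;> norm_num)
    rw [h3, sum_flow (by omega)]
    have h5 : (0 : ℝ) ≤ 1 / ((m : ℝ) + 2) := by positivity
    have h6 : 0 ≤ harmonicGap t * δ := by positivity
    rw [hη]
    nlinarith
  have hD : ∑ i ∈ Finset.range n, stepProb t n i * e i ≤ 2 * δ + (2 * n₀ + 1) / (n + 1) := by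
    have h3 : ∑ i ∈ Finset.range n, stepProb t n i * e i =
        (∑ i ∈ Finset.range n, stepProb t n i) * (β + δ) +
        ∑ i ∈ Finset.range n, stepProb t n i * (if i < n₀ then 1 else 0) -
        ∑ i ∈ Finset.range n, stepProb t n i * b i := by
      rw [Finset.sum_mul, ← Finset.sum_add_distrib, ← Finset.sum_sub_distrib]
      exact Finset.sum_congr rfl fun i _ => by simp only [he]; ring
    rw [h3, sum_stepProb h2tn]
    have h4 := sum_stepProb_initial_le (t := t) (n₀ := n₀) h2tn
    have h5 := hb n (by omega)
    rw [add_div]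
    linarith
  have hE : C * (2 * δ + (2 * n₀ + 1) / (n + 1)) < C * (2 * δ + η / (4 * C)) := by gcongr
  have hF : C * (2 * δ + η / (4 * C)) = η / 2 := by rw [hδ]; field_simp; ring
  have := mul_le_mul_of_nonneg_left hD hC.le
  linarith

/-- The solution of the recurrence with unit toll grows at most linearly. As it is increasing, the
median of a sample from `n` elements may be replaced by the median of a sample from `n + 1` elements
at the cost of an inequality; in terms of `y n / (n + 1)`, this is subharmonicity. -/
theorem eventually_div_le_of_unit_toll {t w : ℕ} (hw : 2 * t + 2 ≤ w) {y : ℕ → ℝ}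
    (h0 : ∀ n < w, y n = 0)
    (hy : ∀ n, w ≤ n + 1 → y (n + 1) = 1 + 2 * medianMean t y n) {ε : ℝ} (hε : 0 < ε) :
    ∀ᶠ n : ℕ in atTop, y n / (n + 1) ≤ 1 / ((w + 1) * harmonicGap t) + ε := by
  have hnn : ∀ n, 0 ≤ y n := by
    intro n
    induction n using Nat.strong_induction_on with
    | _ n ih =>
      by_cases hn : n < w
      · exact (h0 n hn).ge
      · obtain ⟨n, rfl⟩ : ∃ k, n = k + 1 := ⟨n - 1, by omega⟩
        rw [hy n (by omega)]
        have := medianMean_nonneg (t := t) (f := y) (N := n) fun i hi => ih i (by omega)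
        linarith
  have hmono : ∀ n, y n ≤ y (n + 1) := by
    intro n
    induction n using Nat.strong_induction_on with
    | _ n ih =>
      by_cases hn : n < w
      · rw [h0 n hn]; exact hnn _
      · obtain ⟨n, rfl⟩ : ∃ k, n = k + 1 := ⟨n - 1, by omega⟩
        rw [hy n (by omega), hy (n + 1) (by omega)]
        have := medianMean_le_succ (t := t) (f := y) (N := n) (by omega)
          fun i hi => ih i (by omega)
        linarith
  have hsub : ∀ n, w ≤ n → y n ≤ 1 + 2 * medianMean t y n := by
    intro n hn
    obtain ⟨n, rfl⟩ : ∃ k, n = k + 1 := ⟨n - 1, by omega⟩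
    rw [hy n hn]
    have := medianMean_le_succ (t := t) (f := y) (N := n) (by omega) fun i _ => hmono i
    linarith
  have hle : ∀ n, y n ≤ n + 1 := by
    refine le_of_supersolution (t := t) (n₀ := w - 1) zero_le_two ?_ ?_
    · intro n hn
      rw [h0 n (by omega)]
      positivity
    · intro n hn
      rw [hy n (by omega), two_mul_medianMean_succ (by omega)]
      push_cast
      linarith
  have hlim := limsup_le_of_subharmonic (t := t) hw (b := fun n => y n / (n + 1))
    (fun n hn => by simp [h0 n hn]) (fun n => div_nonneg (hnn n) (by positivity))
    (fun n => by
      rw [div_le_one (by positivity)]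
      exact hle n)
    (fun n hn => by
      have h := hsub n hn
      rw [two_mul_medianMean_eq (by omega)] at h
      rw [div_le_iff₀ (by positivity)]
      refine h.trans (le_of_eq ?_)
      have : (0 : ℝ) < n + 1 := by positivity
      field_simp
      ring)
  have hbdd : IsBoundedUnder (· ≤ ·) atTop (fun n : ℕ => y n / ((n : ℝ) + 1)) :=
    isBoundedUnder_of ⟨1, fun n => by
      rw [div_le_one (by positivity)]
      exact hle n⟩
  filter_upwards [eventually_lt_of_limsup_lt (hlim.trans_lt (lt_add_of_pos_right _ hε)) hbdd]
    with n hn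
  exact hn.le

/-! ### The recurrence for means over random jumplists -/

/-- The mean of `f` over the random median-of-`(2t+1)` jumplist on `m` nodes, as a finite sum. -/
noncomputable def expect (w t m : ℕ) (f : Jumplist → ℝ) : ℝ :=
  ∑ J ∈ configs w m, (prob t J : ℝ) * f J

section expect

variable {w t m n : ℕ} {f g : Jumplist → ℝ}

theorem expect_congr (h : ∀ J, J.nodes = m → f J = g J) : expect w t m f = expect w t m g :=
  Finset.sum_congr rfl fun J hJ => by rw [h J (nodes_of_mem_configs _ _ hJ)]

theorem expect_nonneg (h : ∀ J, 0 ≤ f J) : 0 ≤ expect w t m f :=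
  Finset.sum_nonneg fun J _ => mul_nonneg (prob t J).coe_nonneg (h J)

theorem expect_add : expect w t m (fun J => f J + g J) = expect w t m f + expect w t m g := by
  simp [expect, mul_add, Finset.sum_add_distrib]

theorem expect_const_mul (c : ℝ) : expect w t m (fun J => c * f J) = c * expect w t m f := by
  simp only [expect, Finset.mul_sum]
  exact Finset.sum_congr rfl fun _ _ => by ring

theorem expect_const (hw : 2 * t + 2 ≤ w) (c : ℝ) : expect w t m (fun _ => c) = c := by
  have h : ∑ J ∈ configs w m, (prob t J : ℝ) = 1 := by
    exact_mod_cast congrArg NNReal.toReal (sum_prob_configs hw m)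
  simp [expect, ← Finset.sum_mul, h]

theorem expect_sum {ι : Type*} (s : Finset ι) (F : ι → Jumplist → ℝ) :
    expect w t m (fun J => ∑ i ∈ s, F i J) = ∑ i ∈ s, expect w t m (F i) := by
  simp only [expect, Finset.mul_sum]
  exact Finset.sum_comm

theorem expect_of_le (h : m ≤ w) : expect w t m f = f (plain m) := by
  rw [expect, configs, if_pos h]
  simp [prob]

/-- The sizes of the sublists are governed by the median of a random sample; given the sizes, the
sublists are independent random jumplists. -/
theorem expect_add_two (h : w ≤ n + 1) : expect w t (n + 2) f =
    ∑ i ∈ Finset.range n, split t n i *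
      expect w t (i + 1) fun A => expect w t (n - i) fun B => f (jump A B) := by
  rw [expect, configs, if_neg (by omega), Finset.sum_biUnion]
  · rw [← Fin.sum_univ_eq_sum_range (fun i => split t n i *
      expect w t (i + 1) fun A => expect w t (n - i) fun B => f (jump A B)) n]
    refine Finset.sum_congr rfl fun i _ => ?_
    have hi : i.1 < n := i.2
    rw [show n + 2 - 2 - i.1 = n - i.1 by omega,
      Finset.sum_image (by rintro ⟨A, B⟩ - ⟨C, D⟩ - h; simpa using h),
      Finset.sum_product]
    simp only [expect, Finset.mul_sum]
    refine Finset.sum_congr rfl fun A hA => Finset.sum_congr rfl fun B hB => ?_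
    rw [prob, nodes_of_mem_configs _ _ hA, nodes_of_mem_configs _ _ hB, split,
      show i.1 + 1 - 1 = i.1 by omega, show n - i.1 - 1 = n - 1 - i.1 by omega,
      show i.1 + 1 + (n - i.1) - 1 = n by omega]
    push_cast
    ring
  · intro i _ j _ hij
    rw [Function.onFun, Finset.disjoint_left]
    intro J h1 h2
    simp only [Finset.mem_image, Finset.mem_product] at h1 h2
    obtain ⟨P, ⟨hP, -⟩, rfl⟩ := h1
    obtain ⟨Q, ⟨hQ, -⟩, h⟩ := h2
    have hA : Q.1 = P.1 := (jump.inj h).1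
    have := nodes_of_mem_configs _ _ hP
    rw [← hA, nodes_of_mem_configs _ _ hQ] at this
    exact hij (Fin.ext (by omega))

/-- The recurrence for a functional that is a constant toll plus separate contributions of the
two sublists. -/
theorem expect_of_additive {F G : Jumplist → ℝ} (hw : 2 * t + 2 ≤ w) (h : w ≤ n + 1) {c : ℝ}
    (hf : ∀ A B : Jumplist, 1 ≤ A.nodes → 1 ≤ B.nodes → A.nodes + B.nodes = n + 1 →
      f (jump A B) = c + F A + G B) :
    expect w t (n + 2) f = c + medianMean t (fun i => expect w t (i + 1) F) n +
      medianMean t (fun i => expect w t (i + 1) G) n := by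
  have hrefl := medianMean_reflect (t := t) (N := n) (f := fun i => expect w t (i + 1) G)
  rw [expect_add_two h, ← medianMean_const (t := t) (N := n) (by omega) c, ← hrefl, medianMean,
    medianMean, ← Finset.sum_add_distrib, ← Finset.sum_add_distrib]
  refine Finset.sum_congr rfl fun i hi => ?_
  have hi := Finset.mem_range.1 hi
  have h1 : (expect w t (i + 1) fun A => expect w t (n - i) fun B => f (jump A B)) =
      expect w t (i + 1) fun A => c + F A + expect w t (n - i) G := by
    refine expect_congr fun A hA => ?_
    have h2 : (expect w t (n - i) fun B => f (jump A B)) =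
        expect w t (n - i) fun B => (c + F A) + G B :=
      expect_congr fun B hB => hf A B (by omega) (by omega) (by omega)
    rw [h2, expect_add, expect_const hw]
  rw [h1, expect_add, expect_add, expect_const hw, expect_const hw,
    show n - 1 - i + 1 = n - i by omega]
  ring

end expect

/-! ### Means of distributions on `ℕ` -/

/-- The mean of a distribution on `ℕ` as an extended nonnegative number. -/
noncomputable def emean (p : PMF ℕ) : ℝ≥0∞ := ∑' c : ℕ, p c * (c : ℝ≥0∞)

theorem mean_eq_toReal (p : PMF ℕ) : mean p = (emean p).toReal := rfl

theorem mean_nonneg (p : PMF ℕ) : 0 ≤ mean p := ENNReal.toReal_nonneg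

theorem emean_pure (c : ℕ) : emean (PMF.pure c) = c := by
  rw [emean, tsum_eq_single c (fun b hb => by simp [PMF.pure_apply, hb])]
  simp [PMF.pure_apply]

theorem mean_pure (c : ℕ) : mean (PMF.pure c) = c := by
  rw [mean_eq_toReal, emean_pure, ENNReal.toReal_natCast]

theorem emean_bind {α : Type*} (p : PMF α) (f : α → PMF ℕ) :
    emean (p.bind f) = ∑' a, p a * emean (f a) := by
  simp only [emean, PMF.bind_apply, ← ENNReal.tsum_mul_right, ← ENNReal.tsum_mul_left]
  rw [ENNReal.tsum_comm]
  simp only [mul_assoc]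

theorem emean_coin_bind (p : ℝ≥0) (f : Bool → PMF ℕ) :
    emean ((coin p).bind f) =
      ((min p 1 : ℝ≥0) : ℝ≥0∞) * emean (f true) +
        ((1 - min p 1 : ℝ≥0) : ℝ≥0∞) * emean (f false) := by
  rw [emean_bind, tsum_fintype, Fintype.sum_bool]
  simp [coin]

theorem mean_coin_bind (p : ℝ≥0) (f : Bool → PMF ℕ) (h : ∀ b, emean (f b) ≠ ⊤) :
    mean ((coin p).bind f) = ((min p 1 : ℝ≥0) : ℝ) * mean (f true) +
      (1 - ((min p 1 : ℝ≥0) : ℝ)) * mean (f false) := by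
  rw [mean_eq_toReal, emean_coin_bind,
    ENNReal.toReal_add (ENNReal.mul_ne_top ENNReal.coe_ne_top (h _))
      (ENNReal.mul_ne_top ENNReal.coe_ne_top (h _)), ENNReal.toReal_mul, ENNReal.toReal_mul,
    ENNReal.coe_toReal, ENNReal.coe_toReal, NNReal.coe_sub (min_le_right _ _), NNReal.coe_one,
    mean_eq_toReal, mean_eq_toReal]

theorem emean_coin_bind_ne_top (p : ℝ≥0) (f : Bool → PMF ℕ) (h : ∀ b, emean (f b) ≠ ⊤) :
    emean ((coin p).bind f) ≠ ⊤ := by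
  rw [emean_coin_bind]
  exact ENNReal.add_ne_top.2 ⟨ENNReal.mul_ne_top ENNReal.coe_ne_top (h _),
    ENNReal.mul_ne_top ENNReal.coe_ne_top (h _)⟩

theorem mean_random_bind {w t : ℕ} (hw : 2 * t + 2 ≤ w) (m : ℕ) (f : Jumplist → PMF ℕ)
    (h : ∀ J, emean (f J) ≠ ⊤) :
    mean ((random w t hw m).bind f) = expect w t m fun J => mean (f J) := by
  have h1 : ∑' J, random w t hw m J * emean (f J) =
      ∑ J ∈ configs w m, (prob t J : ℝ≥0∞) * emean (f J) := by
    rw [tsum_eq_sum (s := configs w m)]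
    · refine Finset.sum_congr rfl fun J hJ => ?_
      rw [random, PMF.ofFinset_apply, if_pos hJ]
    · intro J hJ
      rw [random, PMF.ofFinset_apply, if_neg hJ, zero_mul]
  rw [mean_eq_toReal, emean_bind, h1,
    ENNReal.toReal_sum fun J _ => ENNReal.mul_ne_top ENNReal.coe_ne_top (h J)]
  simp only [ENNReal.toReal_mul, ENNReal.coe_toReal, expect, mean_eq_toReal]

theorem mean_random_map {w t : ℕ} (hw : 2 * t + 2 ≤ w) (m : ℕ) (f : Jumplist → ℕ) :
    mean ((random w t hw m).map f) = expect w t m fun J => (f J : ℝ) := by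
  rw [PMF.map, mean_random_bind hw m _ fun J => by
    simp [Function.comp, emean_pure]]
  simp only [Function.comp, mean_pure]

/-! ### The total cost of spine searches -/

/-- The number of comparisons of a spine search for a number in gap `gap`, when `J` starts at node
`head` and `last` is the last node jumped to. -/
def searchCost (J : Jumplist) (head last gap : ℕ) : ℕ :=
  let r := bstPhase ((gap : ℚ) + 1 / 2) J head last
  r.2 + (gap - r.1 + 1)

theorem cast_lt_add_half (a b : ℕ) : ((a : ℕ) : ℚ) < (b : ℚ) + 1 / 2 ↔ a ≤ b := by
  constructor
  · intro h
    by_contra! hab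
    have : (b : ℚ) + 1 ≤ a := by exact_mod_cast hab
    linarith
  · intro h
    have : (a : ℚ) ≤ b := by exact_mod_cast h
    linarith

theorem searchCost_jump (A B : Jumplist) (head last gap : ℕ) :
    searchCost (jump A B) head last gap = 1 +
      if head + 1 + A.nodes ≤ gap then
        searchCost B (head + 1 + A.nodes) (head + 1 + A.nodes) gap
      else searchCost A (head + 1) last gap := by
  simp only [searchCost, bstPhase, cast_lt_add_half]
  split_ifs <;> ring

theorem bstPhase_fst_le (J : Jumplist) (head last gap : ℕ) (h : last ≤ gap) :
    (bstPhase ((gap : ℚ) + 1 / 2) J head last).1 ≤ gap := by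
  induction J generalizing head last with
  | plain m => exact h
  | jump A B ihA ihB =>
    simp only [bstPhase, cast_lt_add_half]
    split_ifs with hc
    · exact ihB _ _ hc
    · exact ihA _ _ h

theorem linearPhase_eq (gap rest pos : ℕ) (h1 : pos ≤ gap) (h2 : gap ≤ pos + rest) :
    linearPhase ((gap : ℚ) + 1 / 2) rest pos = gap - pos + 1 := by
  induction rest generalizing pos with
  | zero => simp only [linearPhase]; omega
  | succ rest ih =>
    simp only [linearPhase, cast_lt_add_half]
    split_ifs with hc
    · rw [ih (pos + 1) hc (by omega)]; omega
    · omega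

theorem spineSearchCost_eq (J : Jumplist) (gap : ℕ) (h : gap < J.nodes) :
    spineSearchCost ((gap : ℚ) + 1 / 2) J = searchCost J 0 0 gap := by
  have h1 := bstPhase_fst_le J 0 0 gap (Nat.zero_le _)
  simp only [spineSearchCost, searchCost]
  rw [linearPhase_eq _ _ _ h1 (by omega)]

/-- The increase of the total number of comparisons, over all gaps, when one more gap precedes the
list and the linear searches in the leftmost leaf start one node earlier. -/
def leftSpine : Jumplist → ℕ
  | plain m => m + 1
  | jump A _ => 2 + A.leftSpine

/-- The total number of comparisons of spine searches, one for each gap of the list. -/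
def spineTotal : Jumplist → ℕ
  | plain m => ∑ j ∈ Finset.range m, (j + 1)
  | jump A B => (1 + A.nodes + B.nodes) + (A.spineTotal + A.leftSpine) + B.spineTotal

/-- A sublist reached from the last jump by `e` steps to the next node has to serve also the `e`
gaps in front of it, and its linear searches start `e` nodes earlier. -/
theorem sum_searchCost (J : Jumplist) (last e : ℕ) :
    ∑ g ∈ Finset.range (e + J.nodes), searchCost J (last + e) last (last + g) =
      J.spineTotal + e * J.leftSpine + e.choose 2 := by
  induction J generalizing last e with
  | plain m =>
    have h : ∀ g, searchCost (plain m) (last + e) last (last + g) = g + 1 := by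
      intro g
      simp [searchCost, bstPhase]
    simp only [h, nodes, spineTotal, leftSpine]
    clear h
    induction e with
    | zero => simp
    | succ e ih =>
      rw [show e + 1 + m = (e + m) + 1 by ring, Finset.sum_range_succ, ih, Nat.choose_succ_succ e 1,
        Nat.choose_one_right]
      ring
  | jump A B ihA ihB =>
    have h1 : ∑ g ∈ Finset.range (e + 1 + A.nodes),
        searchCost (jump A B) (last + e) last (last + g) =
        (e + 1 + A.nodes) + ∑ g ∈ Finset.range (e + 1 + A.nodes),
          searchCost A (last + (e + 1)) last (last + g) := by
      have h2 : ∀ g ∈ Finset.range (e + 1 + A.nodes),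
          searchCost (jump A B) (last + e) last (last + g) =
          1 + searchCost A (last + (e + 1)) last (last + g) := by
        intro g hg
        have hg := Finset.mem_range.1 hg
        rw [searchCost_jump, if_neg (by omega), add_assoc]
      rw [Finset.sum_congr rfl h2, Finset.sum_add_distrib]
      simp
    have h3 : ∑ x ∈ Finset.range B.nodes,
        searchCost (jump A B) (last + e) last (last + (e + 1 + A.nodes + x)) =
        B.nodes + ∑ x ∈ Finset.range B.nodes,
          searchCost B (last + e + 1 + A.nodes + 0) (last + e + 1 + A.nodes)
            (last + e + 1 + A.nodes + x) := by
      have h4 : ∀ x ∈ Finset.range B.nodes,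
          searchCost (jump A B) (last + e) last (last + (e + 1 + A.nodes + x)) =
          1 + searchCost B (last + e + 1 + A.nodes + 0) (last + e + 1 + A.nodes)
            (last + e + 1 + A.nodes + x) := by
        intro x _
        rw [searchCost_jump, if_pos (by omega), add_zero,
          show last + (e + 1 + A.nodes + x) = last + e + 1 + A.nodes + x by ring]
      rw [Finset.sum_congr rfl h4, Finset.sum_add_distrib]
      simp
    have hB := ihB (last + e + 1 + A.nodes) 0
    rw [zero_add] at hB
    rw [nodes, show e + (1 + A.nodes + B.nodes) = (e + 1 + A.nodes) + B.nodes by ring,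
      Finset.sum_range_add, h1, h3, ihA last (e + 1), hB, Nat.choose_succ_succ e 1,
      Nat.choose_one_right, spineTotal, leftSpine]
    simp
    ring

theorem sum_mean_spineSearchCost {w t : ℕ} (hw : 2 * t + 2 ≤ w) (n : ℕ) :
    ∑ g ∈ Finset.range (n + 1),
      mean ((random w t hw (n + 1)).map (spineSearchCost ((g : ℚ) + 1 / 2))) =
    expect w t (n + 1) fun J => (J.spineTotal : ℝ) := by
  simp only [mean_random_map]
  rw [← expect_sum]
  refine expect_congr fun J hJ => ?_
  have h := sum_searchCost J 0 0
  simp only [zero_add, zero_mul, add_zero, Nat.choose_zero_succ, hJ] at h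
  rw [← h]
  push_cast
  refine Finset.sum_congr rfl fun g hg => ?_
  rw [spineSearchCost_eq J g (by rw [hJ]; exact Finset.mem_range.1 hg)]

/-! ### The total cost of cleanups after insertions -/

theorem emean_insertCost_ne_top (w t : ℕ) (J : Jumplist) (r : ℕ) :
    emean (insertCost w t J r) ≠ ⊤ := by
  induction J generalizing r with
  | plain m => rw [insertCost, emean_pure]; exact ENNReal.natCast_ne_top _
  | jump A B ihA ihB =>
    rw [insertCost]
    refine emean_coin_bind_ne_top _ _ fun b => ?_
    cases b
    · simp only [Bool.false_eq_true, if_false]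
      split_ifs
      exacts [ihA _, ihB _]
    · simp only [if_true, emean_pure]
      exact ENNReal.natCast_ne_top _

/-- The probability that a list that has grown to `n + 3` nodes is rebalanced. -/
noncomputable def insertProb (t n : ℕ) : ℝ := (2 * t + 1) / (n + 1)

theorem mean_insertCost_jump {w t n : ℕ} (hn : 2 * t ≤ n) {A B : Jumplist}
    (hAB : A.nodes + B.nodes = n + 1) (r : ℕ) :
    mean (insertCost w t (jump A B) r) = insertProb t n * (n + 3) +
      (1 - insertProb t n) * if r ≤ A.nodes + 1 then mean (insertCost w t A (r - 1))
        else mean (insertCost w t B (r - 1 - A.nodes)) := by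
  have hnodes : (jump A B).nodes + 1 = n + 3 := by simp only [nodes]; omega
  have hp : ((min (((2 * t + 1 : ℕ) : ℝ≥0) / ((n + 3 - 2 : ℕ) : ℝ≥0)) 1 : ℝ≥0) : ℝ) =
      insertProb t n := by
    rw [min_eq_left]
    · simp only [insertProb]
      push_cast [show n + 3 - 2 = n + 1 by omega]
      rfl
    · rw [show n + 3 - 2 = n + 1 by omega]
      refine div_le_one_of_le₀ ?_ (by positivity)
      exact_mod_cast (show 2 * t + 1 ≤ n + 1 by omega)
  rw [insertCost, hnodes, mean_coin_bind, hp]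
  · simp only [if_true, Bool.false_eq_true, if_false, mean_pure]
    push_cast
    split_ifs <;> rfl
  · intro b
    cases b
    · simp only [Bool.false_eq_true, if_false]
      split_ifs
      exacts [emean_insertCost_ne_top _ _ _ _, emean_insertCost_ne_top _ _ _ _]
    · simp only [if_true, emean_pure]
      exact ENNReal.natCast_ne_top _

/-- The sum over all positive ranks of the mean cost of the cleanup after an insertion. -/
noncomputable def insertTotal (w t : ℕ) (J : Jumplist) : ℝ :=
  ∑ r ∈ Finset.range J.nodes, mean (insertCost w t J (r + 1))

theorem insertTotal_jump {w t n : ℕ} (hn : 2 * t ≤ n) {A B : Jumplist}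
    (hAB : A.nodes + B.nodes = n + 1) :
    insertTotal w t (jump A B) = (n + 2) * (insertProb t n * (n + 3)) +
      (1 - insertProb t n) * (insertTotal w t A + mean (insertCost w t A 0)) +
      (1 - insertProb t n) * insertTotal w t B := by
  simp only [insertTotal, mean_insertCost_jump hn hAB]
  rw [Finset.sum_add_distrib, Finset.sum_const, Finset.card_range,
    show (jump A B).nodes = (A.nodes + 1) + B.nodes by simp only [nodes]; ring,
    Finset.sum_range_add, ← Finset.mul_sum, ← Finset.mul_sum]
  have h1 : ∑ r ∈ Finset.range (A.nodes + 1),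
      (if r + 1 ≤ A.nodes + 1 then mean (insertCost w t A (r + 1 - 1))
        else mean (insertCost w t B (r + 1 - 1 - A.nodes))) =
      ∑ r ∈ Finset.range A.nodes, mean (insertCost w t A (r + 1)) +
        mean (insertCost w t A 0) := by
    rw [← Finset.sum_range_succ' (fun r => mean (insertCost w t A r))]
    refine Finset.sum_congr rfl fun r hr => ?_
    have hr := Finset.mem_range.1 hr
    rw [if_pos (by omega), Nat.add_sub_cancel]
  have h2 : ∑ x ∈ Finset.range B.nodes,
      (if A.nodes + 1 + x + 1 ≤ A.nodes + 1 then mean (insertCost w t A (A.nodes + 1 + x + 1 - 1))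
        else mean (insertCost w t B (A.nodes + 1 + x + 1 - 1 - A.nodes))) =
      ∑ x ∈ Finset.range B.nodes, mean (insertCost w t B (x + 1)) := by
    refine Finset.sum_congr rfl fun x _ => ?_
    rw [if_neg (by omega), show A.nodes + 1 + x + 1 - 1 - A.nodes = x + 1 by omega]
  rw [h1, h2, nsmul_eq_mul]
  have h3 : ((A.nodes + 1 + B.nodes : ℕ) : ℝ) = n + 2 := by
    rw [show A.nodes + 1 + B.nodes = n + 2 by omega]; push_cast; ring
  rw [h3]
  ring

theorem sum_Icc_one (F : ℕ → ℝ) (n : ℕ) :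
    ∑ r ∈ Finset.Icc 1 n, F r = ∑ r ∈ Finset.range n, F (r + 1) := by
  induction n with
  | zero => simp
  | succ n ih => rw [Finset.sum_Icc_succ_top (by omega), ih, Finset.sum_range_succ]

theorem sum_mean_insertCost {w t : ℕ} (hw : 2 * t + 2 ≤ w) (n : ℕ) :
    ∑ r ∈ Finset.Icc 1 (n + 1), mean ((random w t hw (n + 1)).bind fun J => insertCost w t J r) =
    expect w t (n + 1) (insertTotal w t) := by
  rw [sum_Icc_one]
  simp only [mean_random_bind hw _ _ (fun J => emean_insertCost_ne_top w t J _)]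
  rw [← expect_sum]
  exact expect_congr fun J hJ => by rw [insertTotal, hJ]

/-! ### The total cost of cleanups after deletions -/

theorem emean_deleteCost_ne_top (w t : ℕ) (J : Jumplist) (r : ℕ) :
    emean (deleteCost w t J r) ≠ ⊤ := by
  induction J generalizing r with
  | plain m => rw [deleteCost, emean_pure]; exact ENNReal.natCast_ne_top _
  | jump A B ihA ihB =>
    rw [deleteCost]
    by_cases h : (jump A B).nodes - 1 ≤ w
    · simp only [if_pos h, emean_pure]
      exact ENNReal.natCast_ne_top _
    · simp only [if_neg h]
      refine emean_coin_bind_ne_top _ _ fun b => ?_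
      cases b
      · simp only [Bool.false_eq_true, if_false]
        split_ifs
        exacts [ihA _, ihB _]
      · simp only [if_true, emean_pure]
        exact ENNReal.natCast_ne_top _

/-- The probability, as a real number, that a deletion from the next-sublist of size `J₁` forces a
rebalancing. -/
noncomputable def nextProb (t J₁ : ℕ) : ℝ :=
  ((min (if t = 0 ∧ J₁ = 1 then 1 else (t : ℝ≥0) / (J₁ - 1 : ℕ)) 1 : ℝ≥0) : ℝ)

/-- The probability that a deletion from the jump-sublist of size `J₂` (not of its head) forces a
rebalancing. -/
noncomputable def jumpProb (t J₂ : ℕ) : ℝ := ((min ((t : ℝ≥0) / (J₂ - 1 : ℕ)) 1 : ℝ≥0) : ℝ)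

theorem mean_deleteCost_jump {w t n : ℕ} (hn : w ≤ n) {A B : Jumplist}
    (hAB : A.nodes + B.nodes = n + 1) (r : ℕ) :
    mean (deleteCost w t (jump A B) r) =
      if r < A.nodes + 1 then nextProb t A.nodes * (n + 1) +
        (1 - nextProb t A.nodes) * mean (deleteCost w t A (r - 1))
      else if r = A.nodes + 1 then n + 1
      else jumpProb t B.nodes * (n + 1) +
        (1 - jumpProb t B.nodes) * mean (deleteCost w t B (r - 1 - A.nodes)) := by
  have hnodes : (jump A B).nodes - 1 = n + 1 := by simp only [nodes]; omega
  rw [deleteCost]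
  simp only [hnodes]
  rw [if_neg (by omega), mean_coin_bind]
  · simp only [if_true, Bool.false_eq_true, if_false, mean_pure, deleteProb]
    rcases lt_trichotomy r (A.nodes + 1) with h | h | h
    · simp only [if_pos h, if_neg h.ne, nextProb]
      push_cast
      rfl
    · simp only [if_pos h, if_neg h.not_lt, min_self]
      push_cast
      ring
    · simp only [if_neg h.ne', if_neg h.not_gt, jumpProb]
      push_cast
      rfl
  · intro b
    cases b
    · simp only [Bool.false_eq_true, if_false]
      split_ifs
      exacts [emean_deleteCost_ne_top _ _ _ _, emean_deleteCost_ne_top _ _ _ _]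
    · simp only [if_true, emean_pure]
      exact ENNReal.natCast_ne_top _

/-- The sum over all positive ranks of the mean cost of the cleanup after a deletion. -/
noncomputable def deleteTotal (w t : ℕ) (J : Jumplist) : ℝ :=
  ∑ r ∈ Finset.range (J.nodes - 1), mean (deleteCost w t J (r + 1))

theorem deleteTotal_jump {w t n : ℕ} (hn : w ≤ n) {A B : Jumplist} (hA : 1 ≤ A.nodes)
    (hB : 1 ≤ B.nodes) (hAB : A.nodes + B.nodes = n + 1) :
    deleteTotal w t (jump A B) = (n + 1) +
      ((n + 1) * (nextProb t A.nodes * A.nodes) +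
        (1 - nextProb t A.nodes) * (deleteTotal w t A + mean (deleteCost w t A 0))) +
      ((n + 1) * (jumpProb t B.nodes * (B.nodes - 1)) +
        (1 - jumpProb t B.nodes) * deleteTotal w t B) := by
  simp only [deleteTotal, mean_deleteCost_jump hn hAB]
  rw [show (jump A B).nodes - 1 = (A.nodes + 1) + (B.nodes - 1) by simp only [nodes]; omega,
    Finset.sum_range_add, Finset.sum_range_succ, if_neg (by omega), if_pos rfl]
  have h1 : ∑ r ∈ Finset.range A.nodes, mean (deleteCost w t A r) =
      ∑ r ∈ Finset.range (A.nodes - 1), mean (deleteCost w t A (r + 1)) +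
        mean (deleteCost w t A 0) := by
    rw [← Finset.sum_range_succ' (fun r => mean (deleteCost w t A r)), Nat.sub_add_cancel hA]
  have h2 : ∀ r ∈ Finset.range A.nodes,
      (if r + 1 < A.nodes + 1 then nextProb t A.nodes * ((n : ℝ) + 1) +
        (1 - nextProb t A.nodes) * mean (deleteCost w t A (r + 1 - 1))
      else if r + 1 = A.nodes + 1 then (n : ℝ) + 1
      else jumpProb t B.nodes * (n + 1) +
        (1 - jumpProb t B.nodes) * mean (deleteCost w t B (r + 1 - 1 - A.nodes))) =
      nextProb t A.nodes * (n + 1) + (1 - nextProb t A.nodes) * mean (deleteCost w t A r) := by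
    intro r hr
    have hr := Finset.mem_range.1 hr
    rw [if_pos (by omega), Nat.add_sub_cancel]
  have h3 : ∀ x ∈ Finset.range (B.nodes - 1),
      (if A.nodes + 1 + x + 1 < A.nodes + 1 then nextProb t A.nodes * ((n : ℝ) + 1) +
        (1 - nextProb t A.nodes) * mean (deleteCost w t A (A.nodes + 1 + x + 1 - 1))
      else if A.nodes + 1 + x + 1 = A.nodes + 1 then (n : ℝ) + 1
      else jumpProb t B.nodes * (n + 1) + (1 - jumpProb t B.nodes) *
        mean (deleteCost w t B (A.nodes + 1 + x + 1 - 1 - A.nodes))) =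
      jumpProb t B.nodes * (n + 1) +
        (1 - jumpProb t B.nodes) * mean (deleteCost w t B (x + 1)) := by
    intro x _
    rw [if_neg (by omega), if_neg (by omega),
      show A.nodes + 1 + x + 1 - 1 - A.nodes = x + 1 by omega]
  rw [Finset.sum_congr rfl h2, Finset.sum_congr rfl h3, Finset.sum_add_distrib,
    Finset.sum_add_distrib, Finset.sum_const, Finset.sum_const, ← Finset.mul_sum,
    ← Finset.mul_sum, h1, Finset.card_range, Finset.card_range, nsmul_eq_mul, nsmul_eq_mul,
    Nat.cast_sub hB]
  push_cast
  ring

theorem sum_mean_deleteCost {w t : ℕ} (hw : 2 * t + 2 ≤ w) (n : ℕ) :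
    ∑ r ∈ Finset.Icc 1 n, mean ((random w t hw (n + 1)).bind fun J => deleteCost w t J r) =
    expect w t (n + 1) (deleteTotal w t) := by
  rw [sum_Icc_one]
  simp only [mean_random_bind hw _ _ (fun J => emean_deleteCost_ne_top w t J _)]
  rw [← expect_sum]
  exact expect_congr fun J hJ => by rw [deleteTotal, hJ, Nat.add_sub_cancel]

/-! ### Asymptotics of spine search -/

theorem isEquivalent_log_of_tendsto {u : ℕ → ℝ} {c : ℝ} (hc : c ≠ 0)
    (hu : Tendsto (fun n : ℕ => u n / (((n : ℝ) + 1) * harm (n + 1))) atTop (𝓝 c)) :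
    (fun n : ℕ => u n / ((n : ℝ) + 1)) ~[atTop] fun n : ℕ => c * Real.log n := by
  have hlog : Tendsto (fun n : ℕ => Real.log n) atTop atTop :=
    Real.tendsto_log_atTop.comp tendsto_natCast_atTop_atTop
  have h1 : Tendsto (fun n : ℕ => harm (n + 1) / Real.log n) atTop (𝓝 1) := by
    have h2 : Tendsto (fun n : ℕ => (1 / ((n : ℝ) + 1)) / Real.log n) atTop (𝓝 0) :=
      (tendsto_const_div_succ 1).div_atTop hlog
    have h3 := tendsto_harm_div_log.add h2
    rw [add_zero] at h3
    refine h3.congr fun n => ?_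
    rw [harm_succ]
    ring
  have h4 := (hu.div_const c).mul h1
  rw [div_self hc, one_mul] at h4
  refine isEquivalent_of_tendsto_one (h4.congr' ?_)
  filter_upwards [hlog.eventually_gt_atTop 0] with n hn
  have h5 := one_le_harm_succ n
  have h6 : harm (n + 1) ≠ 0 := by linarith
  simp only [Pi.div_apply]
  field_simp

section leftmost

variable {t : ℕ} {l : ℕ → ℝ} {K : ℝ}

theorem medianMean_le_of_le_harm {n : ℕ} (hn : 2 * t + 1 ≤ n) (hK : 0 ≤ K)
    (hl : ∀ n, l n ≤ K * (harm n + 1)) : medianMean t l n ≤ K * (harm n + 1) := by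
  rw [← medianMean_const (t := t) hn (K * (harm n + 1))]
  refine medianMean_mono fun i hi => (hl i).trans ?_
  have := harm_mono hi.le
  gcongr

theorem tendsto_medianMean_div (hK : 0 ≤ K) (h0 : ∀ n, 0 ≤ l n)
    (hl : ∀ n, l n ≤ K * (harm n + 1)) :
    Tendsto (fun n : ℕ => medianMean t l n / ((n : ℝ) + 1)) atTop (𝓝 0) := by
  have h1 := (tendsto_harm_succ_div.const_mul K).add (tendsto_const_div_succ K)
  rw [mul_zero, add_zero] at h1
  refine squeeze_zero' (Eventually.of_forall fun n =>
    div_nonneg (medianMean_nonneg fun i _ => h0 i) (by positivity)) ?_ h1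
  filter_upwards [eventually_ge_atTop (2 * t + 1)] with n hn
  have h2 := medianMean_le_of_le_harm hn hK hl
  have h3 := harm_mono (show n ≤ n + 1 by omega)
  rw [← mul_div_assoc, ← add_div]
  gcongr
  nlinarith

end leftmost

theorem tendsto_succ_add_div (c : ℝ) :
    Tendsto (fun n : ℕ => ((n : ℝ) + 1 + c) / ((n : ℝ) + 1)) atTop (𝓝 1) := by
  have h := (tendsto_const_div_succ c).const_add 1
  rw [add_zero] at h
  refine h.congr fun n => ?_
  have : (0 : ℝ) < (n : ℝ) + 1 := by positivity
  field_simp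

/-- On `n + 1` keys, the toll is `n + 2`, one comparison for every gap, plus a term of the leftmost branch for the
gap and the node that precede the next-sublist. -/
theorem isEquivalent_expectedSpineSearch {w t : ℕ} (hw : 2 * t + 2 ≤ w) :
    expectedSpineSearch w t hw ~[atTop] fun n : ℕ => 1 / harmonicGap t * Real.log n := by
  set l : ℕ → ℝ := fun n => expect w t (n + 1) fun J => (J.leftSpine : ℝ) with hl
  set s : ℕ → ℝ := fun n => expect w t (n + 1) fun J => (J.spineTotal : ℝ) with hs
  have hl0 : ∀ n, 0 ≤ l n := fun n => expect_nonneg fun J => Nat.cast_nonneg _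
  have hlrec : ∀ n, w ≤ n → l (n + 1) - medianMean t l n ≤ 2 := by
    intro n hn
    have h := expect_of_additive (n := n) (f := fun J => (J.leftSpine : ℝ)) (c := 2)
      (F := fun J => (J.leftSpine : ℝ)) (G := fun _ => 0) hw (by omega)
      (fun A B _ _ _ => by simp [leftSpine])
    simp only [expect_const hw] at h
    rw [medianMean_const (by omega), add_zero] at h
    simp only [hl]
    linarith
  obtain ⟨K, hK, hlK⟩ := exists_le_harm_add_one (by omega) hlrec
  have hsrec : ∀ n, w ≤ n →
      s (n + 1) - 2 * medianMean t s n = ((n : ℝ) + 1 + 1) + medianMean t l n := by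
    intro n hn
    have h := expect_of_additive (n := n) (f := fun J => (J.spineTotal : ℝ)) (c := (n : ℝ) + 1 + 1)
      (F := fun J => (J.spineTotal : ℝ) + J.leftSpine) (G := fun J => (J.spineTotal : ℝ)) hw
      (by omega) (fun A B _ _ hAB => by
        have : (A.nodes : ℝ) + B.nodes = n + 1 := by exact_mod_cast hAB
        simp only [spineTotal]
        push_cast
        linarith)
    simp only [expect_add, medianMean_add] at h
    simp only [hs, hl]
    linarith
  have hlim : Tendsto (fun n : ℕ => (s (n + 1) - 2 * medianMean t s n) / ((n : ℝ) + 1))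
      atTop (𝓝 1) := by
    have h := (tendsto_succ_add_div 1).add (tendsto_medianMean_div (t := t) hK hl0 hlK)
    rw [add_zero] at h
    refine h.congr' ?_
    filter_upwards [eventually_ge_atTop w] with n hn
    rw [hsrec n hn]
    ring
  have hfin := isEquivalent_log_of_tendsto (by have := harmonicGap_pos t; positivity)
    (tendsto_of_toll hlim)
  refine hfin.congr_left (Eventually.of_forall fun n => ?_)
  rw [expectedSpineSearch, sum_mean_spineSearchCost]

/-! ### Asymptotics of the cleanup after insertion -/

theorem insertProb_nonneg (t n : ℕ) : 0 ≤ insertProb t n := by unfold insertProb; positivity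

theorem tendsto_insertProb (t : ℕ) : Tendsto (insertProb t) atTop (𝓝 0) :=
  tendsto_const_div_succ _

theorem medianMean_le_of_le_mul_harm {t n : ℕ} {u : ℕ → ℝ} {K : ℝ} (hn : 2 * t + 1 ≤ n)
    (hK : 0 ≤ K) (hu : ∀ n, u n ≤ K * ((n + 1) * harm (n + 1))) :
    2 * medianMean t u n ≤ K * ((n + 1) * harm (n + 1)) := by
  have h1 : medianMean t u n ≤ K * medianMean t (fun i => ((i : ℝ) + 1) * harm (i + 1)) n := by
    rw [← medianMean_const_mul]
    exact medianMean_mono fun i _ => hu i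
  have h2 := two_mul_medianMean_succ_mul_harm hn
  have h3 := harmonicGap_pos t
  have h4 : 0 ≤ K * (((n : ℝ) + 1) * harmonicGap t) := by positivity
  nlinarith

/-- On `n + 1` keys, the toll is `(n + 2) (n + 3) (2t+1) / (n + 1)`. The factor `1 - insertProb t n` on the sublists
and the insertions in front of the header of the next-sublist change it by `O(log n)` only. -/
theorem isEquivalent_expectedInsert {w t : ℕ} (hw : 2 * t + 2 ≤ w) :
    expectedInsert w t hw ~[atTop]
      fun n : ℕ => ((2 * t + 1 : ℕ) : ℝ) / harmonicGap t * Real.log n := by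
  set l : ℕ → ℝ := fun n => expect w t (n + 1) fun J => mean (insertCost w t J 0) with hl
  set u : ℕ → ℝ := fun n => expect w t (n + 1) (insertTotal w t) with hu
  have hl0 : ∀ n, 0 ≤ l n := fun n => expect_nonneg fun J => mean_nonneg _
  have hu0 : ∀ n, 0 ≤ u n := fun n =>
    expect_nonneg fun J => Finset.sum_nonneg fun r _ => mean_nonneg _
  have hlrec : ∀ n, w ≤ n → l (n + 1) - medianMean t l n ≤ 3 * (2 * t + 1) := by
    intro n hn
    have h := expect_of_additive (n := n) (f := fun J => mean (insertCost w t J 0))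
      (c := insertProb t n * (n + 3))
      (F := fun J => (1 - insertProb t n) * mean (insertCost w t J 0)) (G := fun _ => 0)
      hw (by omega)
      (fun A B _ _ hAB => by
        rw [mean_insertCost_jump (by omega) hAB, if_pos (by omega), add_zero])
    simp only [expect_const hw, expect_const_mul, medianMean_const_mul] at h
    rw [medianMean_const (by omega), add_zero] at h
    have h1 : insertProb t n * (n + 3) ≤ 3 * (2 * t + 1) := by
      rw [insertProb, div_mul_eq_mul_div, div_le_iff₀ (by positivity)]
      have : (0 : ℝ) ≤ (2 * t + 1) * n := by positivity
      nlinarith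
    have h2 : 0 ≤ medianMean t l n := medianMean_nonneg fun i _ => hl0 i
    have h3 := mul_nonneg (insertProb_nonneg t n) h2
    simp only [hl] at h3 ⊢
    linarith
  obtain ⟨K, hK, hlK⟩ := exists_le_harm_add_one (by omega) hlrec
  have hMl := tendsto_medianMean_div (t := t) hK hl0 hlK
  have hurec : ∀ n, w ≤ n → u (n + 1) - 2 * medianMean t u n =
      (n + 2) * (insertProb t n * (n + 3)) + (1 - insertProb t n) * medianMean t l n -
        insertProb t n * (2 * medianMean t u n) := by
    intro n hn
    have h := expect_of_additive (n := n) (f := insertTotal w t)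
      (c := (n + 2) * (insertProb t n * (n + 3)))
      (F := fun J => (1 - insertProb t n) * (insertTotal w t J + mean (insertCost w t J 0)))
      (G := fun J => (1 - insertProb t n) * insertTotal w t J) hw (by omega)
      (fun A B _ _ hAB => insertTotal_jump (by omega) hAB)
    simp only [expect_const_mul, expect_add, medianMean_const_mul, medianMean_add] at h
    simp only [hu, hl]
    linear_combination h
  obtain ⟨n₁, hn₁⟩ := eventually_atTop.1 (hMl.eventually_lt_const one_pos)
  obtain ⟨K', hK', huK⟩ := exists_le_mul_harm (t := t) (n₀ := max n₁ w) (u := u)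
    (C := 6 * (2 * t + 1) + 1) (by omega) (by
    intro n hn
    have hn1 := hn₁ n (by omega)
    have hpos : (0 : ℝ) < (n : ℝ) + 1 := by positivity
    rw [div_lt_one hpos] at hn1
    have h1 := insertProb_nonneg t n
    have h2 : 0 ≤ medianMean t l n := medianMean_nonneg fun i _ => hl0 i
    have h3 : 0 ≤ medianMean t u n := medianMean_nonneg fun i _ => hu0 i
    have h4 : (n + 2) * (insertProb t n * (n + 3)) ≤ 6 * (2 * t + 1) * ((n : ℝ) + 1) := by
      have e : (n + 2) * (insertProb t n * (n + 3)) =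
          ((2 * t + 1) * (((n : ℝ) + 2) * (n + 3))) / (n + 1) := by
        unfold insertProb; field_simp
      have h5 : ((n : ℝ) + 2) * (n + 3) ≤ 6 * ((n + 1) * (n + 1)) := by
        have : (0 : ℝ) ≤ n := n.cast_nonneg
        nlinarith
      rw [e, div_le_iff₀ hpos]
      have := mul_le_mul_of_nonneg_left h5 (show (0 : ℝ) ≤ 2 * t + 1 by positivity)
      linarith
    rw [hurec n (by omega)]
    have h5 := mul_nonneg h1 h2
    have h6 := mul_nonneg h1 h3
    linarith)
  have hMu : Tendsto (fun n : ℕ => insertProb t n * (2 * medianMean t u n) / ((n : ℝ) + 1))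
      atTop (𝓝 0) := by
    have h1 := tendsto_harm_succ_div.const_mul ((2 * t + 1) * K')
    rw [mul_zero] at h1
    refine squeeze_zero' (Eventually.of_forall fun n => ?_) ?_ h1
    · exact div_nonneg (mul_nonneg (insertProb_nonneg t n)
        (mul_nonneg zero_le_two (medianMean_nonneg fun i _ => hu0 i))) (by positivity)
    · filter_upwards [eventually_ge_atTop (2 * t + 1)] with n hn
      have h2 := mul_le_mul_of_nonneg_left (medianMean_le_of_le_mul_harm hn hK' huK)
        (insertProb_nonneg t n)
      have hpos : (0 : ℝ) < (n : ℝ) + 1 := by positivity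
      rw [← mul_div_assoc]
      refine div_le_div_of_nonneg_right (h2.trans (le_of_eq ?_)) hpos.le
      unfold insertProb
      field_simp
  have hlim : Tendsto (fun n : ℕ => (u (n + 1) - 2 * medianMean t u n) / ((n : ℝ) + 1))
      atTop (𝓝 ((2 * t + 1 : ℕ) : ℝ)) := by
    have h1 := ((tendsto_succ_add_div 1).mul (tendsto_succ_add_div 2)).const_mul (2 * t + 1 : ℝ)
    have h2 := ((tendsto_insertProb t).const_sub 1).mul hMl
    have h := (h1.add h2).sub hMu
    have e : (2 * t + 1 : ℝ) * (1 * 1) + (1 - 0) * 0 - 0 = ((2 * t + 1 : ℕ) : ℝ) := by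
      push_cast; ring
    rw [e] at h
    refine h.congr' ?_
    filter_upwards [eventually_ge_atTop w] with n hn
    rw [hurec n hn, sub_div, add_div, insertProb]
    have hpos : (0 : ℝ) < (n : ℝ) + 1 := by positivity
    field_simp
    ring
  have hfin := isEquivalent_log_of_tendsto (by have := harmonicGap_pos t; positivity)
    (tendsto_of_toll hlim)
  refine hfin.congr_left (Eventually.of_forall fun n => ?_)
  rw [expectedInsert, sum_mean_insertCost]

/-! ### Asymptotics of the cleanup after deletion -/

theorem nextProb_nonneg (t J : ℕ) : 0 ≤ nextProb t J := NNReal.coe_nonneg _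

theorem nextProb_le_one (t J : ℕ) : nextProb t J ≤ 1 := by
  unfold nextProb; exact_mod_cast min_le_right _ _

theorem jumpProb_nonneg (t J : ℕ) : 0 ≤ jumpProb t J := NNReal.coe_nonneg _

theorem jumpProb_le_one (t J : ℕ) : jumpProb t J ≤ 1 := by
  unfold jumpProb; exact_mod_cast min_le_right _ _

theorem jumpProb_mul {t i : ℕ} (h : t ≤ i) : jumpProb t (i + 1) * i = t := by
  rcases Nat.eq_zero_or_pos i with rfl | hi
  · simp [Nat.le_zero.1 h]
  · have hi' : (0 : ℝ) < i := by exact_mod_cast hi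
    have h1 : (t : ℝ≥0) / ((i + 1 - 1 : ℕ) : ℝ≥0) ≤ 1 := by
      rw [Nat.add_sub_cancel]
      refine div_le_one_of_le₀ ?_ (by positivity)
      exact_mod_cast h
    rw [jumpProb, min_eq_left h1, Nat.add_sub_cancel]
    push_cast
    field_simp

theorem nextProb_eq_jumpProb {t i : ℕ} (h : ¬ (t = 0 ∧ i = 0)) :
    nextProb t (i + 1) = jumpProb t (i + 1) := by
  rw [nextProb, jumpProb, if_neg (by simpa using h)]

/-- The product is `t` even where `nextProb` is `1` by convention, as `i = 0` there. -/
theorem nextProb_mul {t i : ℕ} (h : t ≤ i) : nextProb t (i + 1) * i = t := by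
  by_cases h0 : t = 0 ∧ i = 0
  · obtain ⟨rfl, rfl⟩ := h0
    simp
  · rw [nextProb_eq_jumpProb h0, jumpProb_mul h]

theorem split_eq_zero {t N i : ℕ} (h : i < t) : split t N i = 0 := by
  simp [split, Nat.choose_eq_zero_of_lt h]

theorem medianMean_mono_of_le {t N : ℕ} {f g : ℕ → ℝ} (h : ∀ i < N, t ≤ i → f i ≤ g i) :
    medianMean t f N ≤ medianMean t g N := by
  refine Finset.sum_le_sum fun i hi => ?_
  by_cases hti : t ≤ i
  · exact mul_le_mul_of_nonneg_left (h i (Finset.mem_range.1 hi) hti) (split_nonneg _ _ _)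
  · rw [split_eq_zero (not_le.1 hti), zero_mul, zero_mul]

theorem medianMean_congr_of_le {t N : ℕ} {f g : ℕ → ℝ} (h : ∀ i < N, t ≤ i → f i = g i) :
    medianMean t f N = medianMean t g N :=
  le_antisymm (medianMean_mono_of_le fun i h1 h2 => (h i h1 h2).le)
    (medianMean_mono_of_le fun i h1 h2 => (h i h1 h2).ge)

/-- The mean probability that a deletion from the next-sublist forces a rebalancing is the same
as for an insertion into a list of this size. -/
theorem medianMean_nextProb {t n : ℕ} (hn : 2 * t + 1 ≤ n) :
    medianMean t (fun i => nextProb t (i + 1)) n = (2 * t + 1) / n := by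
  have hn0 : (0 : ℝ) < n := by exact_mod_cast (show 0 < n by omega)
  obtain ⟨n, rfl⟩ : ∃ k, n = k + 1 := ⟨n - 1, by omega⟩
  rw [medianMean]
  cases t with
  | zero =>
    rw [Finset.sum_eq_single_of_mem 0 (by simp)]
    · simp [split, nextProb]
    · intro i _ hi
      rw [nextProb_eq_jumpProb (by simpa using hi)]
      simp [jumpProb]
  | succ s =>
    have hc := choose_pos_real (t := s + 1) (N := n + 1) hn
    rw [Finset.sum_range_succ', split_eq_zero (Nat.succ_pos s), zero_mul, add_zero]
    have h1 : ∀ i ∈ Finset.range n,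
        split (s + 1) (n + 1) (i + 1) * nextProb (s + 1) (i + 1 + 1) =
        ((i.choose s * (n - 1 - i).choose (s + 1) : ℕ) : ℝ) /
          (n + 1).choose (2 * (s + 1) + 1) := by
      intro i _
      rw [split, show n + 1 - 1 - (i + 1) = n - 1 - i by omega, Nat.cast_mul]
      by_cases hsi : s + 1 ≤ i + 1
      · have h2 := nextProb_mul hsi
        have h3 : ((i + 1 : ℕ) : ℝ) * i.choose s = (i + 1).choose (s + 1) * ((s + 1 : ℕ) : ℝ) := by
          exact_mod_cast Nat.add_one_mul_choose_eq i s
        have h4 : (0 : ℝ) < ((i + 1 : ℕ) : ℝ) := by positivity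
        have h5 : ((i + 1).choose (s + 1) : ℝ) * nextProb (s + 1) (i + 1 + 1) = i.choose s := by
          rw [← mul_right_inj' h4.ne', h3, ← h2]
          ring
        rw [← h5]
        ring
      · rw [Nat.choose_eq_zero_of_lt (by omega : i + 1 < s + 1),
          Nat.choose_eq_zero_of_lt (by omega : i < s)]
        simp
    rw [Finset.sum_congr rfl h1, ← Finset.sum_div, ← Nat.cast_sum, sum_choose_mul_choose]
    have h2 : ((n + 1 : ℕ) : ℝ) * n.choose (2 * (s + 1)) =
        (n + 1).choose (2 * (s + 1) + 1) * ((2 * (s + 1) + 1 : ℕ) : ℝ) := by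
      exact_mod_cast Nat.add_one_mul_choose_eq n (2 * (s + 1))
    rw [show s + (s + 1) + 1 = 2 * (s + 1) by ring, div_eq_div_iff hc.ne' hn0.ne']
    push_cast at h2 ⊢
    linarith

/-- Deleting the target of the jump pointer costs one rebalancing. The other ranks contribute `t`
expected rebalancings for each sublist, since `nextProb` and `jumpProb` are `t / (J - 1)` for size
`J`; this makes `2t+1` rebalancings of `n + 1` nodes up to lower order terms. -/
theorem isEquivalent_expectedDelete {w t : ℕ} (hw : 2 * t + 2 ≤ w) :
    expectedDelete w t hw ~[atTop]
      fun n : ℕ => ((2 * t + 1 : ℕ) : ℝ) / harmonicGap t * Real.log n := by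
  set l : ℕ → ℝ := fun n => expect w t (n + 1) fun J => mean (deleteCost w t J 0) with hl
  set u : ℕ → ℝ := fun n => expect w t (n + 1) (deleteTotal w t) with hu
  set P : ℕ → ℝ := fun n => medianMean t (fun i => nextProb t (i + 1)) n with hP
  have hl0 : ∀ n, 0 ≤ l n := fun n => expect_nonneg fun J => mean_nonneg _
  have hu0 : ∀ n, 0 ≤ u n := fun n =>
    expect_nonneg fun J => Finset.sum_nonneg fun r _ => mean_nonneg _
  -- The mean cost of deleting the header of the next-sublist when no rebalancing takes place above.
  set L : ℕ → ℝ := fun n => medianMean t (fun i => (1 - nextProb t (i + 1)) * l i) n with hL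
  have hL0 : ∀ n, 0 ≤ L n := fun n => medianMean_nonneg fun i _ =>
    mul_nonneg (sub_nonneg.2 (nextProb_le_one _ _)) (hl0 i)
  have hLl : ∀ n, L n ≤ medianMean t l n := fun n => medianMean_mono fun i _ => by
    have := mul_nonneg (nextProb_nonneg t (i + 1)) (hl0 i)
    linarith
  have hlrec : ∀ n, w ≤ n → l (n + 1) - medianMean t l n ≤ 2 * (2 * t + 1) := by
    intro n hn
    have h := expect_of_additive (n := n) (f := fun J => mean (deleteCost w t J 0)) (c := 0)
      (F := fun J => (n + 1) * nextProb t J.nodes +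
        (1 - nextProb t J.nodes) * mean (deleteCost w t J 0)) (G := fun _ => 0)
      hw (by omega)
      (fun A B _ _ hAB => by
        rw [mean_deleteCost_jump hn hAB, if_pos (by omega)]
        ring)
    have h1 : ∀ i, (expect w t (i + 1) fun J => (n + 1) * nextProb t J.nodes +
        (1 - nextProb t J.nodes) * mean (deleteCost w t J 0)) =
        (n + 1) * nextProb t (i + 1) + (1 - nextProb t (i + 1)) * l i := by
      intro i
      rw [expect_congr (g := fun J => (n + 1) * nextProb t (i + 1) +
        (1 - nextProb t (i + 1)) * mean (deleteCost w t J 0)) fun J hJ => by rw [hJ],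
        expect_add, expect_const hw, expect_const_mul]
    simp only [expect_const hw, h1, medianMean_add, medianMean_const_mul] at h
    rw [medianMean_const (by omega), add_zero, zero_add, medianMean_nextProb (by omega)] at h
    have hn0 : (1 : ℝ) ≤ n := by exact_mod_cast (show 1 ≤ n by omega)
    have h2 : ((n : ℝ) + 1) * ((2 * t + 1) / n) ≤ 2 * (2 * t + 1) := by
      rw [← mul_div_assoc, div_le_iff₀ (by linarith)]
      have : (0 : ℝ) ≤ 2 * t + 1 := by positivity
      nlinarith
    have h3 := hLl n
    simp only [hL] at h3
    have h4 : l (n + 1) = expect w t (n + 2) fun J => mean (deleteCost w t J 0) := rfl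
    rw [h4, h]
    linarith
  obtain ⟨K, hK, hlK⟩ := exists_le_harm_add_one (by omega) hlrec
  have hMl := tendsto_medianMean_div (t := t) hK hl0 hlK
  set Q : ℕ → ℝ := fun n => medianMean t (fun i => nextProb t (i + 1) * u i) n +
    medianMean t (fun i => jumpProb t (i + 1) * u i) n with hQ
  have hQ0 : ∀ n, 0 ≤ Q n := fun n => add_nonneg
    (medianMean_nonneg fun i _ => mul_nonneg (nextProb_nonneg _ _) (hu0 i))
    (medianMean_nonneg fun i _ => mul_nonneg (jumpProb_nonneg _ _) (hu0 i))
  have hurec : ∀ n, w ≤ n → u (n + 1) - 2 * medianMean t u n =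
      (n + 1) * (2 * t + 1 + P n) + L n - Q n := by
    intro n hn
    have h := expect_of_additive (n := n) (f := deleteTotal w t) (c := n + 1)
      (F := fun J => (n + 1) * (nextProb t J.nodes * J.nodes) +
        (1 - nextProb t J.nodes) * (deleteTotal w t J + mean (deleteCost w t J 0)))
      (G := fun J => (n + 1) * (jumpProb t J.nodes * (J.nodes - 1)) +
        (1 - jumpProb t J.nodes) * deleteTotal w t J) hw (by omega)
      (fun A B hA hB hAB => deleteTotal_jump hn hA hB hAB)
    have h1 : ∀ i, (expect w t (i + 1) fun J => (n + 1) * (nextProb t J.nodes * J.nodes) +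
        (1 - nextProb t J.nodes) * (deleteTotal w t J + mean (deleteCost w t J 0))) =
        (n + 1) * (nextProb t (i + 1) * (i + 1 : ℕ)) + (1 - nextProb t (i + 1)) * (u i + l i) := by
      intro i
      rw [expect_congr (g := fun J => (n + 1) * (nextProb t (i + 1) * (i + 1 : ℕ)) +
        (1 - nextProb t (i + 1)) * (deleteTotal w t J + mean (deleteCost w t J 0)))
        fun J hJ => by rw [hJ],
        expect_add, expect_const hw, expect_const_mul, expect_add]
    have h2 : ∀ i, (expect w t (i + 1) fun J => (n + 1) * (jumpProb t J.nodes * (J.nodes - 1)) +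
        (1 - jumpProb t J.nodes) * deleteTotal w t J) =
        (n + 1) * (jumpProb t (i + 1) * ((i + 1 : ℕ) - 1)) + (1 - jumpProb t (i + 1)) * u i := by
      intro i
      rw [expect_congr (g := fun J => (n + 1) * (jumpProb t (i + 1) * ((i + 1 : ℕ) - 1)) +
        (1 - jumpProb t (i + 1)) * deleteTotal w t J) fun J hJ => by rw [hJ],
        expect_add, expect_const hw, expect_const_mul]
    simp only [h1, h2] at h
    have h3 : medianMean t (fun i => (n + 1) * (nextProb t (i + 1) * (i + 1 : ℕ)) +
        (1 - nextProb t (i + 1)) * (u i + l i)) n =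
        (n + 1) * (t + P n) + medianMean t u n + L n -
          medianMean t (fun i => nextProb t (i + 1) * u i) n := by
      rw [medianMean_congr_of_le (g := fun i => (n + 1) * (t + nextProb t (i + 1)) + u i +
        (1 - nextProb t (i + 1)) * l i - nextProb t (i + 1) * u i) fun i _ hti => by
          have := nextProb_mul hti
          push_cast
          linear_combination (n + 1 : ℝ) * this]
      rw [medianMean_sub, medianMean_add, medianMean_add, medianMean_const_mul, medianMean_add,
        medianMean_const (by omega)]
    have h4 : medianMean t (fun i => (n + 1) * (jumpProb t (i + 1) * ((i + 1 : ℕ) - 1)) +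
        (1 - jumpProb t (i + 1)) * u i) n =
        (n + 1) * t + medianMean t u n - medianMean t (fun i => jumpProb t (i + 1) * u i) n := by
      rw [medianMean_congr_of_le (g := fun i => (n + 1) * t + u i - jumpProb t (i + 1) * u i)
        fun i _ hti => by
          have := jumpProb_mul hti
          push_cast
          linear_combination (n + 1 : ℝ) * this]
      rw [medianMean_sub, medianMean_add, medianMean_const (by omega)]
    rw [h3, h4] at h
    have h5 : u (n + 1) = expect w t (n + 2) (deleteTotal w t) := rfl
    rw [h5, h]
    simp only [hQ]
    ring
  have hPlim : Tendsto P atTop (𝓝 0) := by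
    refine (tendsto_const_div_atTop_nhds_zero_nat (2 * t + 1 : ℝ)).congr' ?_
    filter_upwards [eventually_ge_atTop (2 * t + 1)] with n hn
    simp only [hP]
    rw [medianMean_nextProb hn]
  obtain ⟨n₁, hn₁⟩ := eventually_atTop.1
    ((hMl.eventually_lt_const one_pos).and (hPlim.eventually_lt_const one_pos))
  obtain ⟨K', hK', huK⟩ := exists_le_mul_harm (t := t) (n₀ := max n₁ w) (u := u)
    (C := 2 * t + 3) (by omega) (by
    intro n hn
    obtain ⟨h1, h2⟩ := hn₁ n (by omega)
    have hpos : (0 : ℝ) < (n : ℝ) + 1 := by positivity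
    rw [div_lt_one hpos] at h1
    rw [hurec n (by omega)]
    have h3 := hQ0 n
    have h4 := hLl n
    nlinarith)
  have hterm : ∀ (p : ℕ → ℝ), (∀ i, 0 ≤ p i) → (∀ i, p i ≤ 1) → (∀ i, t ≤ i → p i * i = t) →
      ∀ n, 2 * t + 1 ≤ n →
        medianMean t (fun i => p i * u i) n ≤ (t + 1) * K' * harm (n + 1) := by
    intro p hp0 hp1 hpt n hn
    rw [← medianMean_const (t := t) hn ((t + 1) * K' * harm (n + 1))]
    refine medianMean_mono_of_le fun i hi hti => ?_
    have h1 := mul_le_mul_of_nonneg_left (huK i) (hp0 i)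
    have h2 : p i * (i + 1) ≤ t + 1 := by
      have := hpt i hti
      have := hp1 i
      linarith
    have h3 := harm_mono (show i + 1 ≤ n + 1 by omega)
    have h4 := harm_nonneg (i + 1)
    calc p i * u i ≤ (p i * (i + 1)) * (K' * harm (i + 1)) := by linarith
      _ ≤ (t + 1) * (K' * harm (n + 1)) := by gcongr
      _ = _ := by ring
  have hMQ : Tendsto (fun n : ℕ => Q n / ((n : ℝ) + 1)) atTop (𝓝 0) := by
    have h1 := tendsto_harm_succ_div.const_mul (2 * ((t + 1) * K'))
    rw [mul_zero] at h1
    refine squeeze_zero' (Eventually.of_forall fun n => div_nonneg (hQ0 n) (by positivity)) ?_ h1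
    filter_upwards [eventually_ge_atTop (2 * t + 1)] with n hn
    have h2 := hterm (fun i => nextProb t (i + 1)) (fun _ => nextProb_nonneg _ _)
      (fun _ => nextProb_le_one _ _) (fun _ => nextProb_mul) n hn
    have h3 := hterm (fun i => jumpProb t (i + 1)) (fun _ => jumpProb_nonneg _ _)
      (fun _ => jumpProb_le_one _ _) (fun _ => jumpProb_mul) n hn
    rw [← mul_div_assoc]
    gcongr
    simp only [hQ]
    linarith
  have hML : Tendsto (fun n : ℕ => L n / ((n : ℝ) + 1)) atTop (𝓝 0) :=
    squeeze_zero (fun n => div_nonneg (hL0 n) (by positivity))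
      (fun n => div_le_div_of_nonneg_right (hLl n) (by positivity)) hMl
  have hlim : Tendsto (fun n : ℕ => (u (n + 1) - 2 * medianMean t u n) / ((n : ℝ) + 1))
      atTop (𝓝 ((2 * t + 1 : ℕ) : ℝ)) := by
    have h := ((hPlim.const_add (2 * t + 1 : ℝ)).add hML).sub hMQ
    have e : (2 * t + 1 : ℝ) + 0 + 0 - 0 = ((2 * t + 1 : ℕ) : ℝ) := by
      push_cast; ring
    rw [e] at h
    refine h.congr' ?_
    filter_upwards [eventually_ge_atTop w] with n hn
    have hpos : (0 : ℝ) < (n : ℝ) + 1 := by positivity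
    rw [hurec n hn]
    field_simp
  have hfin := isEquivalent_log_of_tendsto (by have := harmonicGap_pos t; positivity)
    (tendsto_of_toll hlim)
  have hratio : Tendsto (fun n : ℕ => ((n : ℝ) + 1) / n) atTop (𝓝 1) := by
    have h := (tendsto_const_div_atTop_nhds_zero_nat (1 : ℝ)).const_add 1
    rw [add_zero] at h
    refine h.congr' ?_
    filter_upwards [eventually_gt_atTop 0] with n hn
    have : (0 : ℝ) < n := by exact_mod_cast hn
    field_simp
  have hone : (fun n : ℕ => ((n : ℝ) + 1) / n) ~[atTop] fun _ => (1 : ℝ) :=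
    (isEquivalent_const_iff_tendsto one_ne_zero).2 hratio
  have hprod := hfin.mul hone
  refine (hprod.congr_left (Eventually.of_forall fun n => ?_)).congr_right
    (Eventually.of_forall fun n => mul_one _)
  rw [expectedDelete, sum_mean_deleteCost]
  have hpos : (0 : ℝ) < (n : ℝ) + 1 := by positivity
  simp only [Pi.mul_apply, hu]
  rw [div_mul_div_comm, mul_comm ((n : ℝ) + 1), mul_div_mul_right _ _ hpos.ne']

/-! ### Jump nodes and machine words -/

theorem eventually_expectedJumpFraction_le {w t : ℕ} (hw : 2 * t + 2 ≤ w) {ε : ℝ} (hε : 0 < ε) :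
    ∀ᶠ n : ℕ in atTop, expectedJumpFraction w t hw n ≤ 1 / ((w + 1) * harmonicGap t) + ε := by
  have h := eventually_div_le_of_unit_toll hw
    (y := fun n => expect w t (n + 1) fun J => (J.jumpNodes : ℝ))
    (fun n hn => by rw [expect_of_le (by omega)]; simp [jumpNodes])
    (fun n hn => by
      have h := expect_of_additive (n := n) (f := fun J => (J.jumpNodes : ℝ)) (c := 1)
        (F := fun J => (J.jumpNodes : ℝ)) (G := fun J => (J.jumpNodes : ℝ)) hw hn
        (fun A B _ _ _ => by simp [jumpNodes])
      rw [h]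
      ring) hε
  filter_upwards [h] with n hn
  rwa [expectedJumpFraction, mean_random_map]

theorem words_eq (J : Jumplist) : J.words = J.nodes + 2 * J.jumpNodes := by
  induction J with
  | plain m => simp [words, nodes, jumpNodes]
  | jump A B ihA ihB => simp only [words, nodes, jumpNodes, ihA, ihB]; ring

theorem expectedWordsPerKey_eq {w t : ℕ} (hw : 2 * t + 2 ≤ w) (n : ℕ) :
    expectedWordsPerKey w t hw n =
      ((n : ℝ) + 1) / n * (1 + 2 * expectedJumpFraction w t hw n) := by
  rw [expectedWordsPerKey, expectedJumpFraction, mean_random_map, mean_random_map]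
  have h : (expect w t (n + 1) fun J => (J.words : ℝ)) =
      expect w t (n + 1) fun J => ((n : ℝ) + 1) + 2 * (J.jumpNodes : ℝ) :=
    expect_congr fun J hJ => by rw [words_eq, hJ]; push_cast; ring
  rw [h, expect_add, expect_const hw, expect_const_mul]
  have : (0 : ℝ) < (n : ℝ) + 1 := by positivity
  field_simp

theorem eventually_expectedWordsPerKey_le {w t : ℕ} (hw : 2 * t + 2 ≤ w) {ε : ℝ} (hε : 0 < ε) :
    ∀ᶠ n : ℕ in atTop,
      expectedWordsPerKey w t hw n ≤ 1 + 2 / ((w + 1) * harmonicGap t) + ε := by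
  have hH := harmonicGap_pos t
  set c : ℝ := 1 + 2 * (1 / ((w + 1) * harmonicGap t) + ε / 4) with hc
  have hc0 : 0 < c := by positivity
  have hlim : Tendsto (fun n : ℕ => c / n) atTop (𝓝 0) := tendsto_const_div_atTop_nhds_zero_nat c
  filter_upwards [eventually_expectedJumpFraction_le hw (show 0 < ε / 4 by positivity),
    hlim.eventually_lt_const (half_pos hε), eventually_gt_atTop 0] with n h1 h2 h3
  have hn : (0 : ℝ) < n := by exact_mod_cast h3
  rw [expectedWordsPerKey_eq]
  have e : ((n : ℝ) + 1) / n * c = c + c / n := by field_simp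
  calc ((n : ℝ) + 1) / n * (1 + 2 * expectedJumpFraction w t hw n) ≤ ((n : ℝ) + 1) / n * c := by
        gcongr
        rw [hc]
        linarith
    _ = c + c / n := e
    _ ≤ c + ε / 2 := by linarith
    _ = _ := by rw [hc]; ring

end Jumplist

theorem theorem1 (w t : ℕ) (hw : 2 * t + 2 ≤ w) :
    (Jumplist.expectedSpineSearch w t hw ~[atTop]
      fun n : ℕ => 1 / harmonicGap t * Real.log n) ∧
    (Jumplist.expectedInsert w t hw ~[atTop]
      fun n : ℕ => ((2 * t + 1 : ℕ) : ℝ) / harmonicGap t * Real.log n) ∧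
    (Jumplist.expectedDelete w t hw ~[atTop]
      fun n : ℕ => ((2 * t + 1 : ℕ) : ℝ) / harmonicGap t * Real.log n) ∧
    (∀ ε : ℝ, 0 < ε → ∀ᶠ n : ℕ in atTop,
      Jumplist.expectedJumpFraction w t hw n ≤ 1 / ((w + 1) * harmonicGap t) + ε) ∧
    (∀ ε : ℝ, 0 < ε → ∀ᶠ n : ℕ in atTop,
      Jumplist.expectedWordsPerKey w t hw n ≤ 1 + 2 / ((w + 1) * harmonicGap t) + ε) :=
  ⟨Jumplist.isEquivalent_expectedSpineSearch hw, Jumplist.isEquivalent_expectedInsert hw,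
    Jumplist.isEquivalent_expectedDelete hw,
    fun _ hε => Jumplist.eventually_expectedJumpFraction_le hw hε,
    fun _ hε => Jumplist.eventually_expectedWordsPerKey_le hw hε⟩
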